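/- Let $n\ge 5$. Conventions: $(M,g)$ is a smooth $n$-dimensional manifold with a smooth pseudo-Riemannian metric of any signature, indices are raised and lowered with $g$, a semicolon denotes the Levi-Civita covariant derivative (derivative indices in the order of differentiation, $T_{;ij}=\nabla_j\nabla_i T$), square brackets denote antisymmetrisation with weight one, and indices between vertical bars are not antisymmetrised. $R$ is the scalar curvature in the sign convention $R=g^{bc}R^{a}{}_{bca}$, $R^a{}_{bcd}=\partial_c\Gamma^a_{db}-\partial_d\Gamma^a_{cb}+\Gamma^a_{cm}\Gamma^m_{db}-\Gamma^a_{dm}\Gamma^m_{cb}$, so that a space of constant sectional curvature $K$ has $R=-n(n-1)K$. A Weyl candidate is a tensor field $W_{abcd}$ with $W_{abcd}=W_{[ab]cd}=W_{ab[cd]}$, $W_{abcd}=W_{cdab}$, $W_{a[bcd]}=0$ and $W^a{}_{bad}=0$. A Lanczos potential of $W$ is a tensor field $L_{abc}$ with $L_{abc}=L_{[ab]c}$, $L_{[abc]}=0$ and $$W^{ab}{}_{cd}=2L^{ab}{}_{[c;d]}+2L_{cd}{}^{[a;b]}-\frac{4}{n-2}\delta^{[a}_{[c}\Bigl(L^{b]i}{}_{d];i}-L^{b]i}{}_{|i|;d]}+L_{d]i}{}^{b];i}-L_{d]i}{}^{|i|;b]}\Bigr)+\frac{8}{(n-2)(n-1)}\delta^a_{[c}\delta^b_{d]}L^{ij}{}_{i;j}.$$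 (1) Let $(M,g)$ have constant curvature, and let $W$ be a Weyl candidate on $M$ which fails the constraint $$W^{[ab}{}_{cd;i}{}^{|i|e]}+2W^{[ab}{}_{i[c;d]}{}^{|i|e]}+\frac{4}{n-3}\delta^{[a}_{[c}W^{b|i}{}_{d]j;i}{}^{j|e]}-\frac{2(n-4)}{n(n-1)}R\,W^{[a}{}_c{}^b{}_d{}^{;e]}+\frac{4}{n(n-1)}R\,\delta^{[a}_{[c}W^{b|i|e]}{}_{d];i}=0$$ (that is, $W$ is not three times differentiable, or the equation is violated at some point). Then $W$ has no four times differentiable Lanczos potential $L$ on $M$. (2) If $(M,g)$ is flat, then at every point this constraint is equivalent to the flat one, $$W^{[ab}{}_{cd;i}{}^{|i|e]}+2W^{[ab}{}_{i[c;d]}{}^{|i|e]}+\frac{4}{n-3}\delta^{[a}_{[c}W^{b|i}{}_{d]j;i}{}^{j|e]}=0.$$ (3) In flat space the constraint is an effective restriction: for every choice of signs $\varepsilon_i=\pm1$, the metric $\sum_i\varepsilon_i(dx^i)^2$ on $\mathbb R^n$ is flat and there is a smooth Weyl candidate $W$ on $\mathbb R^n$ which violates the flat constraint at every point; in particular, it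 has no four times differentiable Lanczos potential. -/

import Mathlib

open scoped Manifold ContDiff

namespace Lanczos

noncomputable section

/-! ### Coordinate expressions

Everything in this part lives in one coordinate patch. A tensor field with `k` lower indices is
given there by its components `T I y`, `I` the index tuple and `y` the coordinate point; a metric
by its Gram matrix `G y`. Indices are raised with the inverse matrix `(G y)⁻¹`. -/

/-- The space in which coordinates take their values. -/
abbrev Coord (n : ℕ) := EuclideanSpace ℝ (Fin n)

/-- Component functions of a tensor field with `k` lower indices. -/
abbrev Comp (n k : ℕ) := (Fin k → Fin n) → Coord n → ℝ

/-- The partial derivative `∂ᵢ f`. -/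
def pd {n : ℕ} (i : Fin n) (f : Coord n → ℝ) (y : Coord n) : ℝ :=
  fderiv ℝ f y (EuclideanSpace.single i 1)

/-- `f` is `k` times differentiable (not necessarily continuously) on the open set `s`. -/
def TimesDifferentiableOn {n : ℕ} : ℕ → (Coord n → ℝ) → Set (Coord n) → Prop
  | 0, _, _ => True
  | k + 1, f, s => DifferentiableOn ℝ f s ∧ ∀ i, TimesDifferentiableOn k (pd i f) s

/-- `F_{[ab]} = (F_{ab} - F_{ba}) / 2`. -/
def alt₂ {n : ℕ} (F : Fin n → Fin n → ℝ) (a b : Fin n) : ℝ :=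
  (F a b - F b a) / 2

/-- `F_{[abc]}`, the total antisymmetrisation with weight `1/6`. -/
def alt₃ {n : ℕ} (F : Fin n → Fin n → Fin n → ℝ) (a b c : Fin n) : ℝ :=
  (F a b c + F b c a + F c a b - F b a c - F a c b - F c b a) / 6

section Coordinates

variable {n : ℕ} (G : Coord n → Matrix (Fin n) (Fin n) ℝ)

/-- Christoffel symbols `Γ^m_{ij}` of the Levi-Civita connection. -/
def christoffel (m i j : Fin n) (y : Coord n) : ℝ :=
  ∑ l, (G y)⁻¹ m l *
    (pd i (fun z => G z l j) y + pd j (fun z => G z l i) y - pd l (fun z => G z i j) y) / 2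

/-- The covariant derivative. The new index is the last one, so that `nabla G (nabla G T)` at
`![a, b, i, j]` is `T_{ab;ij}`. -/
def nabla {k : ℕ} (T : Comp n k) : Comp n (k + 1) := fun I y =>
  pd (I (Fin.last k)) (T (Fin.init I)) y
    - ∑ s : Fin k, ∑ m, christoffel G m (I (Fin.last k)) (I s.castSucc) y *
        T (Function.update (Fin.init I) s m) y

/-- `R^a_{bcd} = ∂_c Γ^a_{db} - ∂_d Γ^a_{cb} + Γ^a_{cm} Γ^m_{db} - Γ^a_{dm} Γ^m_{cb}`. -/
def riemann (a b c d : Fin n) (y : Coord n) : ℝ :=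
  pd c (christoffel G a d b) y - pd d (christoffel G a c b) y
    + ∑ m, (christoffel G a c m y * christoffel G m d b y
      - christoffel G a d m y * christoffel G m c b y)

/-- `R_{abcd}`; a space of constant sectional curvature `K` has
`R_{abcd} = K (g_{ac} g_{bd} - g_{ad} g_{bc})`. -/
def riemannLow (a b c d : Fin n) (y : Coord n) : ℝ :=
  ∑ m, G y a m * riemann G m b c d y

/-- The Ricci tensor in the sign convention `R_{bc} = R^a_{bca}`, the trace over the first and the
last index. -/
def ricci (b c : Fin n) (y : Coord n) : ℝ :=
  ∑ a, riemann G a b c a y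

/-- The scalar curvature belonging to `ricci`. With this sign, a space of constant sectional
curvature `K` has scalar curvature `-n(n-1)K`. -/
def scalarCurvature (y : Coord n) : ℝ :=
  ∑ b, ∑ c, (G y)⁻¹ b c * ricci G b c y

/-- `L_b{}^i{}_{d;i} - L_b{}^i{}_{i;d} + L_{dib}{}^{;i} - L_{di}{}^i{}_{;b}`. -/
def lanczosTrace (L : Comp n 3) (b d : Fin n) (y : Coord n) : ℝ :=
  ∑ i, ∑ j, (G y)⁻¹ i j *
    (nabla G L ![b, i, d, j] y - nabla G L ![b, i, j, d] y
      + nabla G L ![d, i, b, j] y - nabla G L ![d, i, j, b] y)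

/-- `L^{ij}{}_{i;j}`. -/
def lanczosScalar (L : Comp n 3) (y : Coord n) : ℝ :=
  ∑ i, ∑ j, ∑ k, ∑ l, (G y)⁻¹ i k * (G y)⁻¹ j l * nabla G L ![i, j, k, l] y

/-- The expression in `L` that a Lanczos potential has to turn into `W_{abcd}`:
`2 L_{ab[c;d]} + 2 L_{cd[a;b]}` minus its trace part. -/
def lanczosExpr (L : Comp n 3) (a b c d : Fin n) (y : Coord n) : ℝ :=
  2 * alt₂ (fun c d => nabla G L ![a, b, c, d] y) c d
    + 2 * alt₂ (fun a b => nabla G L ![c, d, a, b] y) a b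
    - 4 / ((n : ℝ) - 2) *
        alt₂ (fun a b => alt₂ (fun c d => G y a c * lanczosTrace G L b d y) c d) a b
    + 8 / (((n : ℝ) - 2) * ((n : ℝ) - 1)) *
        alt₂ (fun c d => G y a c * G y b d) c d * lanczosScalar G L y

/-- The left-hand side, with all indices lowered, of the constraint of flat space,
`W^{[ab}_{cd;i}^{|i|e]} + 2 W^{[ab}_{i[c;d]}^{|i|e]}
  + 4/(n-3) δ^{[a}_{[c} W^{b|i}_{d]j;i}^{j|e]}`. -/
def flatConstraint (W : Comp n 4) (a b e c d : Fin n) (y : Coord n) : ℝ :=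
  alt₃ (fun a b e => ∑ i, ∑ j, (G y)⁻¹ i j *
      nabla G (nabla G (nabla G W)) ![a, b, c, d, i, j, e] y) a b e
    + 2 * alt₃ (fun a b e => alt₂ (fun c d => ∑ i, ∑ j, (G y)⁻¹ i j *
        nabla G (nabla G (nabla G W)) ![a, b, i, c, d, j, e] y) c d) a b e
    + 4 / ((n : ℝ) - 3) *
      alt₃ (fun a b e => alt₂ (fun c d => G y a c *
        ∑ i, ∑ j, ∑ k, ∑ l, (G y)⁻¹ i k * (G y)⁻¹ j l *
          nabla G (nabla G (nabla G W)) ![b, i, d, j, k, l, e] y) c d) a b e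

/-- The left-hand side, with all indices lowered, of the constraint of a space of constant
curvature: the flat one plus
`-2(n-4)/(n(n-1)) R W^{[a}_c^b_d^{;e]} + 4/(n(n-1)) R δ^{[a}_{[c} W^{b|i|e]}_{d];i}`. -/
def curvedConstraint (W : Comp n 4) (a b e c d : Fin n) (y : Coord n) : ℝ :=
  flatConstraint G W a b e c d y
    - 2 * ((n : ℝ) - 4) / ((n : ℝ) * ((n : ℝ) - 1)) * scalarCurvature G y *
      alt₃ (fun a b e => nabla G W ![a, c, b, d, e] y) a b e
    + 4 / ((n : ℝ) * ((n : ℝ) - 1)) * scalarCurvature G y *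
      alt₃ (fun a b e => alt₂ (fun c d => G y a c *
        ∑ i, ∑ j, (G y)⁻¹ i j * nabla G W ![b, i, e, d, j] y) c d) a b e

end Coordinates

/-! ### Tensor fields on a manifold

The charts below are those of the given atlas; all the notions are tensorial, hence do not depend
on the choice of an atlas of the smooth structure. -/

/-- The coordinate vector field `∂_a` of the chart `φ`, at the point with coordinates `y`. -/
def frame {n : ℕ} {M : Type*} [TopologicalSpace M] [ChartedSpace (Coord n) M]
    (φ : OpenPartialHomeomorph M (Coord n)) (y : Coord n) (a : Fin n) :
    TangentSpace (𝓡 n) (φ.symm y) :=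
  mfderiv (𝓡 n) (𝓡 n) φ.symm y (EuclideanSpace.single a (1 : ℝ) : Coord n)

/-- Tensor fields with `k` lower indices (no regularity assumed). -/
abbrev TensorField (n : ℕ) (M : Type*) [TopologicalSpace M] [ChartedSpace (Coord n) M] (k : ℕ) :=
  (x : M) → MultilinearMap ℝ (fun _ : Fin k => TangentSpace (𝓡 n) x) ℝ

/-- A smooth pseudo-Riemannian metric, of any signature. -/
structure Metric (n : ℕ) (M : Type*) [TopologicalSpace M] [ChartedSpace (Coord n) M] where
  /-- the bilinear form on each tangent space -/
  form : (x : M) → LinearMap.BilinForm ℝ (TangentSpace (𝓡 n) x)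
  symm : ∀ x u v, form x u v = form x v u
  nondegenerate : ∀ x u, (∀ v, form x u v = 0) → u = 0
  smooth : ∀ φ ∈ atlas (Coord n) M, ∀ a b : Fin n,
    ContDiffOn ℝ ∞ (fun y => form (φ.symm y) (frame φ y a) (frame φ y b)) φ.target

section Manifold

variable {n : ℕ} {M : Type*} [TopologicalSpace M] [ChartedSpace (Coord n) M]

/-- The components of a tensor field in the chart `φ`. -/
def comp {k : ℕ} (φ : OpenPartialHomeomorph M (Coord n)) (T : TensorField n M k) : Comp n k :=
  fun I y => T (φ.symm y) (fun s => frame φ y (I s))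

/-- The Gram matrix of the metric in the chart `φ`. -/
def gram (φ : OpenPartialHomeomorph M (Coord n)) (g : Metric n M) (y : Coord n) :
    Matrix (Fin n) (Fin n) ℝ :=
  Matrix.of fun a b => g.form (φ.symm y) (frame φ y a) (frame φ y b)

/-- The tensor field is `r` times differentiable. -/
def TimesDifferentiable {k : ℕ} (r : ℕ) (T : TensorField n M k) : Prop :=
  ∀ φ ∈ atlas (Coord n) M, ∀ I, TimesDifferentiableOn r (comp φ T I) φ.target

/-- The tensor field is smooth. -/
def IsSmooth {k : ℕ} (T : TensorField n M k) : Prop :=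
  ∀ φ ∈ atlas (Coord n) M, ∀ I, ContDiffOn ℝ ∞ (comp φ T I) φ.target

/-- `(M, g)` has constant (sectional) curvature `K`. -/
def HasConstantCurvature (g : Metric n M) (K : ℝ) : Prop :=
  ∀ φ ∈ atlas (Coord n) M, ∀ y ∈ φ.target, ∀ a b c d,
    riemannLow (gram φ g) a b c d y =
      K * (gram φ g y a c * gram φ g y b d - gram φ g y a d * gram φ g y b c)

/-- `(M, g)` is flat: its curvature tensor vanishes. -/
def IsFlat (g : Metric n M) : Prop :=
  ∀ φ ∈ atlas (Coord n) M, ∀ y ∈ φ.target, ∀ a b c d, riemannLow (gram φ g) a b c d y = 0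

/-- Weyl candidates: 4-tensors with the algebraic symmetries of the Weyl tensor. -/
structure IsWeylCandidate (g : Metric n M) (W : TensorField n M 4) : Prop where
  antisymm_left : ∀ φ ∈ atlas (Coord n) M, ∀ y ∈ φ.target, ∀ a b c d,
    comp φ W ![a, b, c, d] y = alt₂ (fun a b => comp φ W ![a, b, c, d] y) a b
  antisymm_right : ∀ φ ∈ atlas (Coord n) M, ∀ y ∈ φ.target, ∀ a b c d,
    comp φ W ![a, b, c, d] y = alt₂ (fun c d => comp φ W ![a, b, c, d] y) c d
  pair_symm : ∀ φ ∈ atlas (Coord n) M, ∀ y ∈ φ.target, ∀ a b c d,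
    comp φ W ![a, b, c, d] y = comp φ W ![c, d, a, b] y
  cyclic : ∀ φ ∈ atlas (Coord n) M, ∀ y ∈ φ.target, ∀ a b c d,
    alt₃ (fun b c d => comp φ W ![a, b, c, d] y) b c d = 0
  trace_free : ∀ φ ∈ atlas (Coord n) M, ∀ y ∈ φ.target, ∀ b d,
    ∑ a, ∑ c, (gram φ g y)⁻¹ a c * comp φ W ![a, b, c, d] y = 0

/-- The algebraic symmetries `L_{abc} = L_{[ab]c}`, `L_{[abc]} = 0`. -/
structure HasLanczosSymmetry (L : TensorField n M 3) : Prop where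
  antisymm : ∀ φ ∈ atlas (Coord n) M, ∀ y ∈ φ.target, ∀ a b c,
    comp φ L ![a, b, c] y = alt₂ (fun a b => comp φ L ![a, b, c] y) a b
  cyclic : ∀ φ ∈ atlas (Coord n) M, ∀ y ∈ φ.target, ∀ a b c,
    alt₃ (fun a b c => comp φ L ![a, b, c] y) a b c = 0

/-- `L` is a Lanczos potential of `W`. -/
structure IsLanczosPotential (g : Metric n M) (W : TensorField n M 4) (L : TensorField n M 3) :
    Prop where
  symmetry : HasLanczosSymmetry L
  eq : ∀ φ ∈ atlas (Coord n) M, ∀ y ∈ φ.target, ∀ a b c d,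
    comp φ W ![a, b, c, d] y = lanczosExpr (gram φ g) (comp φ L) a b c d y

/-- The constraint of flat space holds at the point `x`. -/
def FlatConstraintAt (g : Metric n M) (W : TensorField n M 4) (x : M) : Prop :=
  ∀ φ ∈ atlas (Coord n) M, x ∈ φ.source → ∀ a b e c d,
    flatConstraint (gram φ g) (comp φ W) a b e c d (φ x) = 0

/-- The constraint of spaces of constant curvature holds at the point `x`. -/
def CurvedConstraintAt (g : Metric n M) (W : TensorField n M 4) (x : M) : Prop :=
  ∀ φ ∈ atlas (Coord n) M, x ∈ φ.source → ∀ a b e c d,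
    curvedConstraint (gram φ g) (comp φ W) a b e c d (φ x) = 0

/-- `W` satisfies the constraint: it has the three derivatives that occur in it, and the equation
holds everywhere. -/
def SatisfiesCurvedConstraint (g : Metric n M) (W : TensorField n M 4) : Prop :=
  TimesDifferentiable 3 W ∧ ∀ x, CurvedConstraintAt g W x

end Manifold

/-! ### Flat space -/

/-- The bilinear form `∑ i, ε i uⁱ vⁱ`, `ε i = ±1`. -/
def flatForm {n : ℕ} (ε : Fin n → ℤˣ) : LinearMap.BilinForm ℝ (Coord n) :=
  LinearMap.mk₂ ℝ (fun u v : Coord n => ∑ i, ((ε i : ℤ) : ℝ) * (u i * v i))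
    (fun u u' v => by
      simp only [PiLp.add_apply, ← Finset.sum_add_distrib]
      exact Finset.sum_congr rfl fun i _ => by ring)
    (fun c u v => by
      simp only [PiLp.smul_apply, smul_eq_mul, Finset.mul_sum]
      exact Finset.sum_congr rfl fun i _ => by ring)
    (fun u v v' => by
      simp only [PiLp.add_apply, ← Finset.sum_add_distrib]
      exact Finset.sum_congr rfl fun i _ => by ring)
    (fun c u v => by
      simp only [PiLp.smul_apply, smul_eq_mul, Finset.mul_sum]
      exact Finset.sum_congr rfl fun i _ => by ring)

theorem flatForm_symm {n : ℕ} (ε : Fin n → ℤˣ) (u v : Coord n) :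
    flatForm ε u v = flatForm ε v u := by
  simp only [flatForm, LinearMap.mk₂_apply]
  exact Finset.sum_congr rfl fun i _ => by ring

theorem flatForm_nondegenerate {n : ℕ} (ε : Fin n → ℤˣ) (u : Coord n)
    (h : ∀ v, flatForm ε u v = 0) : u = 0 := by
  ext i
  have hi := h (EuclideanSpace.single i (1 : ℝ))
  simp only [flatForm, LinearMap.mk₂_apply] at hi
  rw [Finset.sum_eq_single i] at hi
  · simpa using hi
  · intro j _ hj
    simp [hj]
  · simp

/-- The flat metric `∑ i, ε i (dxⁱ)²` on the space of Cartesian coordinates, `ε i = ±1`. -/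
def flatMetric {n : ℕ} (ε : Fin n → ℤˣ) : Metric n (Coord n) where
  form _ := flatForm ε
  symm _ u v := flatForm_symm ε u v
  nondegenerate _ u h := flatForm_nondegenerate ε u h
  smooth φ hφ a b := by
    rw [chartedSpaceSelf_atlas] at hφ
    subst hφ
    have hf : ∀ (y : Coord n) (c : Fin n),
        frame (OpenPartialHomeomorph.refl (Coord n)) y c =
          (EuclideanSpace.single c (1 : ℝ) : Coord n) := by
      intro y c
      have hid : mfderiv (𝓡 n) (𝓡 n) (OpenPartialHomeomorph.refl (Coord n)).symm y =
          ContinuousLinearMap.id ℝ (TangentSpace (𝓡 n) y) := mfderiv_id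
      unfold frame
      rw [hid]
      rfl
    simp only [hf]
    exact contDiffOn_const

end

end Lanczos

/-!
Let `L` be a Lanczos potential of `W` in a space of constant curvature `K`. Up to trace terms,
`W_{abcd}` is `L_{abc;d} - L_{abd;c} + L_{cda;b} - L_{cdb;a}`; the trace terms are
`g_{ac} P_{bd} - g_{bc} P_{ad} - g_{ad} P_{bc} + g_{bd} P_{ac}` with a symmetric tensor `P`, here
called `schouten`. Regard `L` as a form with values in forms. The exterior derivative of `W` in the
second pair of indices eliminates the first half of this expression, and it leaves the exterior
derivative, in the first pair, of `H_{acdi} = L_{cda;i} + L_{dia;c} + L_{ica;d}`. Its divergence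
`divCurl` is therefore, up to a multiple of `W` and terms with a factor `g`, the exterior
derivative in the first pair of a tensor `Z` (`JetRelations.divCurl_eq`). The terms with a factor
`g` are found by taking the trace (`JetRelations.divCurl_add_divDiv`): their coefficient is
`z_{d;b}`, with `z` the trace of `Z`, up to terms of first order in `L` and the double divergence
of `W`. A further exterior derivative in the first pair annihilates both exterior derivatives up to
curvature. What remains is `K` times `g`, times an expression of second order in `L`, and this
vanishes by a direct computation (`FullJetRelations.pot_antisymm`). The result,
`FullJetRelations.constraint_eq_zero`, is the constraint.

All of this is algebra in the components of `L` and its covariant derivatives at one point. The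
required relations between them, collected in `FullJetRelations`, are the symmetries of `L`, the
Ricci identities, and the derivatives of both. They are obtained from the notion of a parallel index
operation (`IsParallel`): an operation on arrays built from permutations of indices, multiplication
with the metric and contraction commutes with covariant differentiation, so that an identity
between the images of tensor fields under such operations may be differentiated
(`IsParallel.transfer`).

In flat space the scalar curvature vanishes and the two constraints agree. A Weyl candidate that
violates the flat constraint is `W = (x⁴)³ C`, where `C` is a constant tensor with the symmetries of
the Weyl tensor that involves only the coordinates `x⁰, …, x³`, all four of them in each nonzero
component; then `C` is trace-free in any signature. The only derivative of third order that occurs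
is `∂₄³`, so that the component `(a, b, e, c, d) = (0, 1, 4, 2, 3)` of the constraint reduces to the
one of its first term, which is `±2`.
-/

namespace Lanczos

/-! ### Contraction with the inverse metric -/

section Algebra

variable {n : ℕ}

/-- `h` is the inverse of the symmetric matrix `g`. -/
structure IsInversePair (g h : Matrix (Fin n) (Fin n) ℝ) : Prop where
  symm : ∀ i j, g i j = g j i
  symm_inv : ∀ i j, h i j = h j i
  mul_inv : ∀ a b, ∑ i, g a i * h i b = if a = b then 1 else 0

/-- The contraction `h^{ij} f_{ij}`. -/
def ctr (h : Matrix (Fin n) (Fin n) ℝ) (f : Fin n → Fin n → ℝ) : ℝ :=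
  ∑ i, ∑ j, h i j * f i j

variable {g h : Matrix (Fin n) (Fin n) ℝ}

theorem ctr_add (f f' : Fin n → Fin n → ℝ) :
    ctr h (fun i j => f i j + f' i j) = ctr h f + ctr h f' := by
  simp only [ctr, mul_add, Finset.sum_add_distrib]

theorem ctr_sub (f f' : Fin n → Fin n → ℝ) :
    ctr h (fun i j => f i j - f' i j) = ctr h f - ctr h f' := by
  simp only [ctr, mul_sub, Finset.sum_sub_distrib]

theorem ctr_neg (f : Fin n → Fin n → ℝ) :
    ctr h (fun i j => -f i j) = -ctr h f := by
  simp only [ctr, mul_neg, Finset.sum_neg_distrib]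

theorem ctr_const_mul (c : ℝ) (f : Fin n → Fin n → ℝ) :
    ctr h (fun i j => c * f i j) = c * ctr h f := by
  simp only [ctr, Finset.mul_sum]
  exact Finset.sum_congr rfl fun i _ => Finset.sum_congr rfl fun j _ => by ring

theorem ctr_zero : ctr h (fun _ _ => 0) = 0 := by simp [ctr]

theorem ctr_congr {f f' : Fin n → Fin n → ℝ} (H : ∀ i j, f i j = f' i j) :
    ctr h f = ctr h f' := by
  rw [funext₂ H]

theorem ctr_ctr_comm (f : Fin n → Fin n → Fin n → Fin n → ℝ) :
    ctr h (fun a c => ctr h (fun i j => f a c i j)) =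
      ctr h (fun i j => ctr h (fun a c => f a c i j)) := by
  simp only [ctr, Finset.mul_sum]
  have e : ∀ F : Fin n → Fin n → Fin n → Fin n → ℝ,
      ∑ a, ∑ c, ∑ i, ∑ j, F a c i j = ∑ i, ∑ j, ∑ a, ∑ c, F a c i j := by
    intro F
    have s : ∀ a, ∑ c, ∑ i, ∑ j, F a c i j = ∑ i, ∑ j, ∑ c, F a c i j := by
      intro a
      rw [Finset.sum_comm]
      exact Finset.sum_congr rfl fun i _ => Finset.sum_comm
    rw [Finset.sum_congr rfl fun a _ => s a, Finset.sum_comm]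
    exact Finset.sum_congr rfl fun i _ => Finset.sum_comm
  rw [e]
  exact Finset.sum_congr rfl fun i _ => Finset.sum_congr rfl fun j _ =>
    Finset.sum_congr rfl fun a _ => Finset.sum_congr rfl fun c _ => by ring

namespace IsInversePair

variable (hg : IsInversePair g h)
include hg

theorem inv_mul (a b : Fin n) : ∑ i, h a i * g i b = if b = a then 1 else 0 := by
  rw [← hg.mul_inv]
  exact Finset.sum_congr rfl fun i _ => by rw [hg.symm_inv a i, hg.symm b i]; ring

theorem ctr_swap (f : Fin n → Fin n → ℝ) : ctr h (fun i j => f j i) = ctr h f := by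
  simp only [ctr]
  rw [Finset.sum_comm]
  exact Finset.sum_congr rfl fun i _ => Finset.sum_congr rfl fun j _ => by rw [hg.symm_inv]

theorem ctr_g_left (a : Fin n) (f : Fin n → ℝ) : ctr h (fun i j => g a i * f j) = f a := by
  simp only [ctr]
  rw [Finset.sum_comm]
  have e : ∀ j, ∑ i, h i j * (g a i * f j) = (if a = j then 1 else 0) * f j := by
    intro j
    rw [← hg.mul_inv, Finset.sum_mul]
    exact Finset.sum_congr rfl fun i _ => by ring
  simp [e]

theorem ctr_g_left' (a : Fin n) (f : Fin n → ℝ) : ctr h (fun i j => g i a * f j) = f a := by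
  rw [← hg.ctr_g_left a f]
  exact ctr_congr fun i j => by rw [hg.symm]

theorem ctr_g_right (a : Fin n) (f : Fin n → ℝ) : ctr h (fun i j => g a j * f i) = f a := by
  rw [← hg.ctr_g_left a f, ← hg.ctr_swap]

theorem ctr_g_right' (a : Fin n) (f : Fin n → ℝ) : ctr h (fun i j => g j a * f i) = f a := by
  rw [← hg.ctr_g_right a f]
  exact ctr_congr fun i j => by rw [hg.symm j]

theorem ctr_g (c : ℝ) : ctr h (fun i j => g i j * c) = n * c := by
  simp only [ctr]
  have e : ∀ i, ∑ j, h i j * (g i j * c) = c := by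
    intro i
    have := hg.mul_inv i i
    rw [if_pos rfl] at this
    calc ∑ j, h i j * (g i j * c) = (∑ j, g i j * h j i) * c := by
          rw [Finset.sum_mul]
          exact Finset.sum_congr rfl fun j _ => by rw [hg.symm_inv i j]; ring
      _ = c := by rw [this, one_mul]
  simp [e]

theorem ctr_antisymm {f : Fin n → Fin n → ℝ} (H : ∀ i j, f i j = -f j i) : ctr h f = 0 := by
  have e : ctr h f = -ctr h f := by
    conv_lhs => rw [← hg.ctr_swap]
    rw [← ctr_neg]
    exact ctr_congr fun i j => H j i
  linarith

end IsInversePair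

/-! ### The Lanczos expression as an index operation -/

/-- Arrays with four indices. -/
abbrev Arr₄ (n : ℕ) := Fin n → Fin n → Fin n → Fin n → ℝ

/-- Arrays with six indices. -/
abbrev Arr₆ (n : ℕ) := Fin n → Fin n → Arr₄ n

/-- `λ_{bd} = L_{dib;}{}^i` for `X_{abcd} = L_{abc;d}`. -/
def lam (h : Matrix (Fin n) (Fin n) ℝ) (X : Arr₄ n) (b d : Fin n) : ℝ :=
  ctr h fun i j => X d i b j

/-- `v_{b;d}`, where `v_b = L_{bi}{}^i`, for `X_{abcd} = L_{abc;d}`. -/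
def dvec (h : Matrix (Fin n) (Fin n) ℝ) (X : Arr₄ n) (b d : Fin n) : ℝ :=
  ctr h fun i j => X b i j d

/-- `L^{ij}{}_{i;j}` for `X_{abcd} = L_{abc;d}`. -/
def scal (h : Matrix (Fin n) (Fin n) ℝ) (X : Arr₄ n) : ℝ :=
  ctr h fun j l => ctr h fun i k => X i j k l

/-- The symmetric tensor `P` for which the trace part of the Lanczos expression is
`g_{ac} P_{bd} - g_{bc} P_{ad} - g_{ad} P_{bc} + g_{bd} P_{ac}`. -/
noncomputable def schouten (g h : Matrix (Fin n) (Fin n) ℝ) (X : Arr₄ n) (b d : Fin n) : ℝ :=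
  (lam h X b d + lam h X d b - dvec h X b d - dvec h X d b) / ((n : ℝ) - 2)
    - 2 * scal h X / (((n : ℝ) - 2) * ((n : ℝ) - 1)) * g b d

/-- The Lanczos expression as a function of the array `X_{abcd} = L_{abc;d}`. -/
noncomputable def weylOp (g h : Matrix (Fin n) (Fin n) ℝ) (X : Arr₄ n) (a b c d : Fin n) : ℝ :=
  X a b c d - X a b d c + X c d a b - X c d b a
    - (g a c * schouten g h X b d - g b c * schouten g h X a d
      - g a d * schouten g h X b c + g b d * schouten g h X a c)

/-- The symmetries of a Lanczos potential in the first three indices of an array. -/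
structure LanczosSymm (X : Arr₄ n) : Prop where
  anti : ∀ a b c d, X a b c d = -X b a c d
  cyc : ∀ a b c d, X a b c d + X b c a d + X c a b d = 0

section Traces

variable {X : Arr₄ n}

theorem schouten_symm (hg : IsInversePair g h) (X : Arr₄ n) (b d : Fin n) :
    schouten g h X b d = schouten g h X d b := by
  simp only [schouten, hg.symm b d]; ring

theorem ctr_lam (hg : IsInversePair g h) : ctr h (fun b d => lam h X b d) = scal h X := by
  rw [← hg.ctr_swap]
  simp only [lam, scal]
  rw [ctr_ctr_comm]

theorem ctr_dvec (hX : LanczosSymm X) : ctr h (fun b d => dvec h X b d) = -scal h X := by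
  simp only [dvec, scal]
  rw [← ctr_neg]
  refine ctr_congr fun b d => ?_
  rw [← ctr_neg]
  exact ctr_congr fun i j => by rw [hX.anti]

theorem ctr_schouten (hg : IsInversePair g h) (hX : LanczosSymm X) (hn : 5 ≤ n) :
    ctr h (fun b d => schouten g h X b d) = 2 * scal h X / ((n : ℝ) - 1) := by
  have hn' : (5 : ℝ) ≤ n := by exact_mod_cast hn
  have h1 : (n : ℝ) - 1 ≠ 0 := by linarith
  have h2 : (n : ℝ) - 2 ≠ 0 := by linarith
  have e : ∀ b d, schouten g h X b d = ((n : ℝ) - 2)⁻¹ *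
      (lam h X b d + lam h X d b - dvec h X b d - dvec h X d b)
        - g b d * (2 * scal h X / (((n : ℝ) - 2) * ((n : ℝ) - 1))) := by
    intro b d; simp only [schouten]; ring
  rw [ctr_congr e]
  simp only [ctr_sub, ctr_const_mul, ctr_add, hg.ctr_g]
  rw [hg.ctr_swap (lam h X), hg.ctr_swap (dvec h X)]
  rw [ctr_lam hg, ctr_dvec hX]
  field_simp
  ring

theorem schouten_eq (hn : 5 ≤ n) (X : Arr₄ n) (b d : Fin n) :
    ((n : ℝ) - 2) * schouten g h X b d =
      lam h X b d + lam h X d b - dvec h X b d - dvec h X d b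
        - 2 * scal h X / ((n : ℝ) - 1) * g b d := by
  have hn' : (5 : ℝ) ≤ n := by exact_mod_cast hn
  have h1 : (n : ℝ) - 1 ≠ 0 := by linarith
  have h2 : (n : ℝ) - 2 ≠ 0 := by linarith
  simp only [schouten]
  field_simp

theorem weylOp_anti_left (hX : LanczosSymm X) (a b c d : Fin n) :
    weylOp g h X a b c d = -weylOp g h X b a c d := by
  simp only [weylOp]
  rw [hX.anti a b c d, hX.anti a b d c]; ring

theorem weylOp_anti_right (hX : LanczosSymm X) (a b c d : Fin n) :
    weylOp g h X a b c d = -weylOp g h X a b d c := by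
  simp only [weylOp]
  rw [hX.anti c d a b, hX.anti c d b a]; ring

theorem weylOp_cyclic (hg : IsInversePair g h) (hX : LanczosSymm X) (a b c d : Fin n) :
    weylOp g h X a c b d - weylOp g h X b c a d = weylOp g h X a b c d := by
  simp only [weylOp]
  rw [hg.symm b a, hg.symm c a, hg.symm c b, hg.symm c d, schouten_symm hg X b a,
    schouten_symm hg X c a, schouten_symm hg X c b, schouten_symm hg X c d]
  linear_combination -hX.cyc a b c d + hX.cyc a b d c - hX.cyc c d a b + hX.cyc c d b a
    + hX.anti a c b d - hX.anti a d b c + hX.anti a d c b - hX.anti b d c a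

/-- The Lanczos expression is trace-free. -/
theorem ctr_weylOp (hg : IsInversePair g h) (hX : LanczosSymm X) (hn : 5 ≤ n) (b d : Fin n) :
    ctr h (fun a c => weylOp g h X a b c d) = 0 := by
  have hn' : (5 : ℝ) ≤ n := by exact_mod_cast hn
  have h1 : (n : ℝ) - 1 ≠ 0 := by linarith
  have e : ∀ a c, weylOp g h X a b c d = -X b a c d + X b a d c + -X d c a b + X d c b a
      - (g a c * schouten g h X b d - g b c * schouten g h X a d
      - g d a * schouten g h X b c + g b d * schouten g h X a c) := by
    intro a c
    simp only [weylOp]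
    rw [hX.anti a b c d, hX.anti a b d c, hX.anti c d a b, hX.anti c d b a, hg.symm a d]
    ring
  rw [ctr_congr e]
  simp only [ctr_sub, ctr_const_mul, ctr_add, ctr_neg, hg.ctr_g, hg.ctr_g_left, hg.ctr_g_right,
    ctr_schouten hg hX hn]
  rw [hg.ctr_swap (fun a c => X d a c b), hg.ctr_swap (fun a c => X d a b c)]
  have := schouten_eq (g := g) (h := h) hn X b d
  simp only [lam, dvec] at this
  linear_combination -this

end Traces

end Algebra

/-! ### The third-order part of the constraint -/

section ThirdOrder

variable {n : ℕ} {g h : Matrix (Fin n) (Fin n) ℝ}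

/-- The algebraic relations between `X_{abcd} = L_{abc;d}` and `Z_{abcdij} = L_{abc;dij}` in a
space of constant curvature `K`: the symmetries of `L` and the Ricci identities for the first two
and for the last two derivatives. -/
structure JetRelations (g : Matrix (Fin n) (Fin n) ℝ) (K : ℝ) (X : Arr₄ n) (Z : Arr₆ n) :
    Prop where
  symm_one : LanczosSymm X
  symm_three : ∀ i j, LanczosSymm fun a b c d => Z a b c d i j
  ricci_inner : ∀ a b c i j k, Z a b c i j k - Z a b c j i k =
    K * (g a j * X i b c k - g a i * X j b c k + g b j * X a i c k - g b i * X a j c k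
      + g c j * X a b i k - g c i * X a b j k)
  ricci_outer : ∀ a b c d i j, Z a b c d i j - Z a b c d j i =
    K * (g a j * X i b c d - g a i * X j b c d + g b j * X a i c d - g b i * X a j c d
      + g c j * X a b i d - g c i * X a b j d + g d j * X a b c i - g d i * X a b c j)

/-- `H_{acdi} = L_{cda;i} + L_{dia;c} + L_{ica;d}`, for `X_{abcd} = L_{abc;d}`. -/
def cycDeriv (X : Arr₄ n) (a c d i : Fin n) : ℝ := X c d a i + X d i a c + X i c a d

/-- `H_{acdi;jb}`. -/
def cycDeriv₃ (Z : Arr₆ n) (a c d i j b : Fin n) : ℝ :=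
  cycDeriv (fun p q r s => Z p q r s j b) a c d i

/-- `P_{bd;ij}`. -/
noncomputable def schouten₃ (g h : Matrix (Fin n) (Fin n) ℝ) (Z : Arr₆ n) (b d i j : Fin n) : ℝ :=
  schouten g h (fun p q r s => Z p q r s i j) b d

/-- The divergence of the exterior derivative of `W` in its second pair of indices,
`W_{abcd;i}{}^i + W_{abic;d}{}^i + W_{abdi;c}{}^i`. -/
noncomputable def divCurl (g h : Matrix (Fin n) (Fin n) ℝ) (Z : Arr₆ n) (a b c d : Fin n) : ℝ :=
  ctr h fun i j => weylOp g h (fun p q r s => Z p q r s i j) a b c d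
    + weylOp g h (fun p q r s => Z p q r s d j) a b i c
    + weylOp g h (fun p q r s => Z p q r s c j) a b d i

/-- `q_{bd} = P_{bd;i}{}^i - P_{bi;d}{}^i`. -/
noncomputable def divCotton (g h : Matrix (Fin n) (Fin n) ℝ) (Z : Arr₆ n) (b d : Fin n) : ℝ :=
  ctr h fun i j => schouten₃ g h Z b d i j - schouten₃ g h Z b i d j

/-- `Z_{acd;b}` for the tensor
`Z_{acd} = H_{acdi;}{}^i + P_{ac;d} - P_{ad;c} + (2n-6) K L_{cda}`. -/
noncomputable def dPot (g h : Matrix (Fin n) (Fin n) ℝ) (K : ℝ) (X : Arr₄ n) (Z : Arr₆ n)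
    (a c d b : Fin n) : ℝ :=
  ctr h (fun i j => cycDeriv₃ Z a c d i j b)
    + (schouten₃ g h Z a c d b - schouten₃ g h Z a d c b) + (2 * (n : ℝ) - 6) * K * X c d a b

/-- The coefficient `q_{bd} + 2 K λ_{bd} + (n-4) K P_{bd}` of the metric in
`divCurl_eq`. -/
noncomputable def qHat (g h : Matrix (Fin n) (Fin n) ℝ) (K : ℝ) (X : Arr₄ n) (Z : Arr₆ n)
    (b d : Fin n) : ℝ :=
  divCotton g h Z b d + 2 * K * lam h X b d + ((n : ℝ) - 4) * K * schouten g h X b d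

theorem cycDeriv_swap {X : Arr₄ n} (hX : LanczosSymm X) (a c d i : Fin n) :
    cycDeriv X a d c i = -cycDeriv X a c d i := by
  simp only [cycDeriv]
  linear_combination hX.anti d c a i + hX.anti c i a d + hX.anti i d a c

theorem cycDeriv_swap' {X : Arr₄ n} (hX : LanczosSymm X) (a c d i : Fin n) :
    cycDeriv X a c i d = -cycDeriv X a c d i := by
  simp only [cycDeriv]
  linear_combination hX.anti d c a i + hX.anti c i a d + hX.anti i d a c

/-- `h_{bd} = H_i{}^i{}_{bd}`. -/
def trCycDeriv (h : Matrix (Fin n) (Fin n) ℝ) (X : Arr₄ n) (b d : Fin n) : ℝ :=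
  ctr h fun i j => cycDeriv X i j b d

/-- `W_{bidj;}{}^{ij}`. -/
noncomputable def divDiv (g h : Matrix (Fin n) (Fin n) ℝ) (Z : Arr₆ n) (b d : Fin n) : ℝ :=
  ctr h fun i k => ctr h fun j l => weylOp g h (fun p q r s => Z p q r s k l) b i d j

/-- `z_{d;b}`, where `z_d = Z_a{}^a{}_d`. -/
noncomputable def dTrPot (g h : Matrix (Fin n) (Fin n) ℝ) (K : ℝ) (X : Arr₄ n) (Z : Arr₆ n)
    (d b : Fin n) : ℝ :=
  ctr h fun a c => dPot g h K X Z a c d b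

theorem ctr_ctr_symmetrize {F F' : Fin n → Fin n → Fin n → Fin n → ℝ}
    (H : ∀ a b i j, F a b i j + F i j a b = F' a b i j) :
    2 * ctr h (fun a b => ctr h fun i j => F a b i j) =
      ctr h fun a b => ctr h fun i j => F' a b i j := by
  simp only [← H, ctr_add]
  rw [ctr_ctr_comm fun a b i j => F i j a b]
  ring

theorem trCycDeriv_swap {X : Arr₄ n} (hX : LanczosSymm X) (b d : Fin n) :
    trCycDeriv h X b d = -trCycDeriv h X d b := by
  rw [trCycDeriv, trCycDeriv, ← ctr_neg]
  exact ctr_congr fun i j => by rw [cycDeriv_swap' hX]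

variable {K : ℝ} {X : Arr₄ n} {Z : Arr₆ n}

namespace JetRelations

variable (J : JetRelations g K X Z)
include J

/-- The exterior derivative, in the second pair of indices, of `L_{abc;d} - L_{abd;c}` is a
curvature term: an exterior derivative is applied twice. -/
theorem curl_left (hg : IsInversePair g h) (a b c d i j : Fin n) :
    (Z a b c d i j - Z a b d c i j) + (Z a b i c d j - Z a b c i d j)
      + (Z a b d i c j - Z a b i d c j) =
    -K * (g a i * X c d b j + g a c * X d i b j + g a d * X i c b j
      - (g b i * X c d a j + g b c * X d i a j + g b d * X i c a j)) := by
  have s := fun p q r => J.symm_one.anti p q r j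
  have t := fun p q r => J.symm_one.cyc p q r j
  linear_combination J.ricci_inner a b c d i j + J.ricci_inner a b d i c j
    + J.ricci_inner a b i c d j + K * g a i * (t c d b - s c b d)
    + K * g a c * (t d i b - s d b i) + K * g a d * (t i c b - s i b c)
    - K * g b i * (t c d a - s a d c)
    - K * g b c * (t d i a - s a i d) - K * g b d * (t i c a - s a c i)
    - K * X a b c j * hg.symm d i - K * X a b d j * hg.symm i c - K * X a b i j * hg.symm c d

/-- The exterior derivative, in the second pair of indices, of `L_{cda;b} - L_{cdb;a}`: the two
exterior derivatives act on different pairs, hence commute up to curvature. -/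
theorem curl_right (hg : IsInversePair g h) (a b c d i j : Fin n) :
    (Z c d a b i j - Z c d b a i j) + (Z i c a b d j - Z i c b a d j)
      + (Z d i a b c j - Z d i b a c j) =
    cycDeriv₃ Z a c d i b j - cycDeriv₃ Z b c d i a j
    -K * (g a i * X c d b j + g a c * X d i b j + g a d * X i c b j
      - (g b i * X c d a j + g b c * X d i a j + g b d * X i c a j)) := by
  have s := fun p q r => J.symm_one.anti p q r j
  simp only [cycDeriv₃, cycDeriv]
  linear_combination J.ricci_inner c d a b i j - J.ricci_inner c d b a i j
    + J.ricci_inner i c a b d j - J.ricci_inner i c b a d j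
    + J.ricci_inner d i a b c j - J.ricci_inner d i b a c j
    + K * g c i * (s b d a - s a d b) + K * g d i * (s c b a - s c a b)
    + K * g c d * (s i b a - s i a b) - 2 * K * g b c * s i d a - 2 * K * g b d * s c i a
    - 2 * K * g b i * s d c a + 2 * K * g a i * s c d b + 2 * K * g a d * s i c b
    + 2 * K * g a c * s d i b
    + K * (X d a b j - X d b a j) * hg.symm c i + K * (X a c b j - X b c a j) * hg.symm d i
    + K * (X a i b j - X b i a j) * hg.symm c d - 2 * K * X i d a j * hg.symm c b
    - 2 * K * X c i a j * hg.symm d b - 2 * K * X d c b j * hg.symm a i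
    - 2 * K * X d c a j * hg.symm i b - 2 * K * X c i b j * hg.symm a d
    - 2 * K * X i d b j * hg.symm a c
    - K * (X c d i j + X i c d j + X d i c j) * hg.symm a b

theorem cycDeriv_comm (a c d i j b : Fin n) :
    cycDeriv₃ Z a c d i b j - cycDeriv₃ Z a c d i j b =
      K * (g a j * cycDeriv X b c d i - g a b * cycDeriv X j c d i
        + g c j * cycDeriv X a b d i - g c b * cycDeriv X a j d i
        + g d j * cycDeriv X a c b i - g d b * cycDeriv X a c j i
        + g i j * cycDeriv X a c d b - g i b * cycDeriv X a c d j) := by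
  simp only [cycDeriv₃, cycDeriv]
  linear_combination J.ricci_outer c d a i b j + J.ricci_outer d i a c b j
    + J.ricci_outer i c a d b j

/-- The divergence of `H_{acdi;b}` in its last index is the derivative of the divergence of `H`,
up to curvature. -/
theorem ctr_cycDeriv_comm (hg : IsInversePair g h) (a c d b : Fin n) :
    ctr h (fun i j => cycDeriv₃ Z a c d i b j) = ctr h (fun i j => cycDeriv₃ Z a c d i j b)
      + K * (cycDeriv X b c d a - g a b * ctr h (fun i j => cycDeriv X j c d i)
        + ((n : ℝ) - 3) * cycDeriv X a c d b) := by
  have hX := J.symm_one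
  have e : ∀ i j, cycDeriv₃ Z a c d i b j = cycDeriv₃ Z a c d i j b +
      K * (g a j * cycDeriv X b c d i - g a b * cycDeriv X j c d i
        + g c j * cycDeriv X a b d i - g c b * cycDeriv X a j d i
        + g d j * cycDeriv X a c b i - g d b * cycDeriv X a c j i
        + g i j * cycDeriv X a c d b - g b i * cycDeriv X a c d j) := by
    intro i j
    rw [hg.symm b i]
    linear_combination J.cycDeriv_comm a c d i j b
  rw [ctr_congr e]
  simp only [ctr_sub, ctr_const_mul, ctr_add, hg.ctr_g, hg.ctr_g_left, hg.ctr_g_right]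
  rw [hg.ctr_antisymm (f := fun i j => cycDeriv X a j d i)
      (fun i j => by rw [cycDeriv_swap hX, cycDeriv_swap' hX, cycDeriv_swap hX]; ring),
    hg.ctr_antisymm (f := fun i j => cycDeriv X a c j i) (fun i j => cycDeriv_swap' hX ..)]
  rw [cycDeriv_swap hX a d b c, cycDeriv_swap' hX a d c b, cycDeriv_swap hX a c d b,
    cycDeriv_swap' hX a c d b]
  ring

theorem cycDeriv_sub (a b c d : Fin n) :
    cycDeriv X a c d b - cycDeriv X b c d a =
      (X c d a b - X c d b a) - (X a b c d - X a b d c) := by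
  have s := J.symm_one.anti
  have t := J.symm_one.cyc
  simp only [cycDeriv]
  linear_combination t a b c d - t a b d c - s c a b d + s b d a c

/-- Up to the exterior derivative, in the first pair of indices, of a tensor, and a multiple of
`W`, the tensor `divCurl` is pure trace. -/
theorem divCurl_eq (hg : IsInversePair g h) (a b c d : Fin n) :
    divCurl g h Z a b c d + ((n : ℝ) - 4) * K * weylOp g h X a b c d =
      dPot g h K X Z a c d b - dPot g h K X Z b c d a
        - (g a c * qHat g h K X Z b d - g b c * qHat g h K X Z a d
          - g a d * qHat g h K X Z b c + g b d * qHat g h K X Z a c) := by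
  have s := J.symm_one.anti
  have e : ∀ i j, weylOp g h (fun p q r s => Z p q r s i j) a b c d
    + weylOp g h (fun p q r s => Z p q r s d j) a b i c
    + weylOp g h (fun p q r s => Z p q r s c j) a b d i =
      cycDeriv₃ Z a c d i b j - cycDeriv₃ Z b c d i a j
      - 2 * K * (g a i * X c d b j + g a c * X d i b j - g a d * X c i b j
      - (g b i * X c d a j + g b c * X d i a j - g b d * X c i a j))
      - (g a c * (schouten₃ g h Z b d i j - schouten₃ g h Z b i d j)
        - g b c * (schouten₃ g h Z a d i j - schouten₃ g h Z a i d j)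
        - g a d * (schouten₃ g h Z b c i j - schouten₃ g h Z b i c j)
        + g b d * (schouten₃ g h Z a c i j - schouten₃ g h Z a i c j)
        + g a i * (schouten₃ g h Z b c d j - schouten₃ g h Z b d c j)
        - g b i * (schouten₃ g h Z a c d j - schouten₃ g h Z a d c j)) := by
    intro i j
    simp only [weylOp, schouten₃]
    linear_combination J.curl_left hg a b c d i j + J.curl_right hg a b c d i j
      - 2 * K * g a d * s i c b j + 2 * K * g b d * s i c a j
  rw [divCurl, ctr_congr e]
  simp only [ctr_sub, ctr_const_mul, ctr_add, hg.ctr_g_left]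
  rw [J.ctr_cycDeriv_comm hg, J.ctr_cycDeriv_comm hg]
  simp only [dPot, qHat, divCotton, lam, weylOp]
  simp only [ctr_sub]
  have t := J.cycDeriv_sub a b c d
  linear_combination ((n : ℝ) - 4) * K * t
    - K * ctr h (fun i j => cycDeriv X j c d i) * hg.symm a b

/-- The double divergence of `H`, which is antisymmetric in the two indices, is a curvature term. -/
theorem ctr_ctr_cycDeriv (hg : IsInversePair g h) (b d : Fin n) :
    ctr h (fun a c => ctr h fun i j => cycDeriv₃ Z b c d i j a) = K * trCycDeriv h X b d := by
  have hX := J.symm_one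
  have sw : ∀ p q r s, cycDeriv X p s r q = -cycDeriv X p q r s := fun p q r s => by
    rw [cycDeriv_swap hX, cycDeriv_swap' hX, cycDeriv_swap hX]; ring
  have H3 : ∀ a c i j, cycDeriv₃ Z b i d c a j = -cycDeriv₃ Z b c d i a j := by
    intro a c i j
    have hZ := J.symm_three a j
    simp only [cycDeriv₃]
    rw [cycDeriv_swap hZ, cycDeriv_swap' hZ, cycDeriv_swap hZ]; ring
  have key : ∀ a c i j, cycDeriv₃ Z b c d i j a + cycDeriv₃ Z b i d c a j =
      K * (g b a * cycDeriv X j c d i - g b j * cycDeriv X a c d i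
        + g c a * cycDeriv X b j d i - g c j * cycDeriv X b a d i
        + g d a * cycDeriv X b c j i - g d j * cycDeriv X b c a i
        + g a i * cycDeriv X b c d j - g i j * cycDeriv X b c d a) := by
    intro a c i j
    rw [H3 a c i j, hg.symm a i]
    linear_combination J.cycDeriv_comm b c d i a j
  have e := ctr_ctr_symmetrize (h := h) (F := fun c a i j => cycDeriv₃ Z b c d i j a)
      (fun c a i j => key a c i j)
  rw [hg.ctr_swap fun a c => ctr h fun i j => cycDeriv₃ Z b c d i j a] at e
  simp only [ctr_sub, ctr_const_mul, ctr_add, hg.ctr_g, hg.ctr_g_left, hg.ctr_g_right] at e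
  have t₁ : ctr h (fun i j => cycDeriv X j b d i) = trCycDeriv h X b d := by
    rw [trCycDeriv, ← hg.ctr_swap fun i j => cycDeriv X i j b d]
    exact ctr_congr fun i j => by rw [cycDeriv_swap' hX, cycDeriv_swap hX]; ring
  have t₂ : ctr h (fun i j => cycDeriv X j i d b) = -trCycDeriv h X b d := by
    rw [← trCycDeriv_swap hX, trCycDeriv, ← hg.ctr_swap fun i j => cycDeriv X i j d b]
  have t₃ : ctr h (fun i j => cycDeriv X b j d i) = 0 := hg.ctr_antisymm fun i j => sw _ _ _ _
  have t₄ : ctr h (fun i j => cycDeriv X b d j i) = 0 :=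
    hg.ctr_antisymm fun i j => cycDeriv_swap' hX _ _ _ _
  have t₅ : ctr h (fun i j => cycDeriv X b i j d) = 0 :=
    hg.ctr_antisymm fun i j => cycDeriv_swap hX _ _ _ _
  have t₆ : ctr h (cycDeriv X b · d ·) = 0 := hg.ctr_antisymm fun i j => sw _ _ _ _
  rw [t₁, t₂, t₃, t₄, t₅, t₆] at e
  linarith

/-- `trΘ_{bd} = -W_{bidj;}{}^{ij}`, because `W` is trace-free. -/
theorem ctr_divCurl (hg : IsInversePair g h) (hn : 5 ≤ n) (b d : Fin n) :
    ctr h (fun a c => divCurl g h Z a b c d) = -divDiv g h Z b d := by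
  have hZ := J.symm_three
  simp only [divCurl, divDiv, ctr_add]
  rw [ctr_ctr_comm fun a c i j => weylOp g h (fun p q r s => Z p q r s i j) a b c d,
    ctr_ctr_comm fun a c i j => weylOp g h (fun p q r s => Z p q r s d j) a b i c]
  simp only [ctr_weylOp hg (hZ _ _) hn]
  have e₂ : ctr h (fun i j => ctr h fun a c =>
      weylOp g h (fun p q r s => Z p q r s d j) a b i c) = 0 := by
    rw [← ctr_zero (h := h)]
    refine ctr_congr fun i j => ?_
    rw [ctr_congr fun a c => weylOp_anti_right (hZ d j) a b i c, ctr_neg,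
      ctr_weylOp hg (hZ d j) hn, neg_zero]
  have e₃ : ctr h (fun a c => ctr h fun i j =>
      weylOp g h (fun p q r s => Z p q r s c j) a b d i) =
      -ctr h fun a c => ctr h fun i j => weylOp g h (fun p q r s => Z p q r s c j) b a d i := by
    rw [← ctr_neg]
    refine ctr_congr fun a c => ?_
    rw [← ctr_neg]
    exact ctr_congr fun i j => weylOp_anti_left (hZ c j) ..
  rw [e₂, e₃, ctr_zero]
  ring

theorem ctr_divDiv (hg : IsInversePair g h) (hn : 5 ≤ n) :
    ctr h (fun b d => divDiv g h Z b d) = 0 := by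
  simp only [divDiv]
  rw [ctr_ctr_comm]
  simp only [ctr_ctr_comm (h := h) fun b d j l => weylOp g h _ b _ d j]
  simp only [ctr_weylOp hg (J.symm_three _ _) hn, ctr_zero]

/-- The double divergence of the trace of `H` vanishes. -/
theorem ctr_ctr_ctr_cycDeriv (hg : IsInversePair g h) :
    ctr h (fun d b => ctr h fun i j => ctr h fun a c => cycDeriv₃ Z a c d i j b) = 0 := by
  have hX := J.symm_one
  have sw : ∀ p q r s, cycDeriv X p s r q = -cycDeriv X p q r s := fun p q r s => by
    rw [cycDeriv_swap hX, cycDeriv_swap' hX, cycDeriv_swap hX]; ring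
  have key : ∀ d b i j, ctr h (fun a c => cycDeriv₃ Z a c d i j b)
      + ctr h (fun a c => cycDeriv₃ Z a c i d b j) =
      K * (ctr h (fun a c => g a b * cycDeriv X j c d i)
        - ctr h (fun a c => g a j * cycDeriv X b c d i)
        + ctr h (fun a c => g c b * cycDeriv X a j d i)
        - ctr h (fun a c => g c j * cycDeriv X a b d i)
        + g d b * trCycDeriv h X j i - g d j * trCycDeriv h X b i
        + g b i * trCycDeriv h X d j - g i j * trCycDeriv h X d b) := by
    intro d b i j
    simp only [trCycDeriv, ← ctr_const_mul, ← ctr_add, ← ctr_sub]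
    refine ctr_congr fun a c => ?_
    have H3 : cycDeriv₃ Z a c i d b j = -cycDeriv₃ Z a c d i b j :=
      cycDeriv_swap' (J.symm_three b j) a c d i
    rw [H3, hg.symm b i]
    linear_combination J.cycDeriv_comm a c d i b j
  have e := ctr_ctr_symmetrize (h := h)
      (F := fun d b i j => ctr h fun a c => cycDeriv₃ Z a c d i j b) key
  simp only [ctr_sub, ctr_const_mul, ctr_add, hg.ctr_g, hg.ctr_g_left, hg.ctr_g_right,
    hg.ctr_g_left', hg.ctr_g_right'] at e
  rw [hg.ctr_antisymm (f := fun i j => trCycDeriv h X j i) fun i j => trCycDeriv_swap hX _ _,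
    hg.ctr_antisymm (trCycDeriv_swap hX)] at e
  linarith

/-- The trace of `divCurl_eq`. -/
theorem ctr_divCurl_eq (hg : IsInversePair g h) (hn : 5 ≤ n) (b d : Fin n) :
    -divDiv g h Z b d = dTrPot g h K X Z d b - K * trCycDeriv h X b d
      - ((n : ℝ) - 3) * divCotton g h Z b d - 2 * K * lam h X b d
      - ((n : ℝ) - 2) * ((n : ℝ) - 4) * K * schouten g h X b d
      - g b d * ctr h (fun i j => qHat g h K X Z i j) := by
  have hX := J.symm_one
  rw [← J.ctr_divCurl hg hn]
  have e : ∀ a c, divCurl g h Z a b c d = dPot g h K X Z a c d b - dPot g h K X Z b c d a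
        - (g a c * qHat g h K X Z b d - g b c * qHat g h K X Z a d
          - g d a * qHat g h K X Z b c + g b d * qHat g h K X Z a c)
        - ((n : ℝ) - 4) * K * weylOp g h X a b c d := fun a c => by
    rw [hg.symm d a]; linear_combination J.divCurl_eq hg a b c d
  have e₁ : ctr h (fun a c => dPot g h K X Z b c d a) = K * trCycDeriv h X b d
      - divCotton g h Z b d - (2 * (n : ℝ) - 6) * K * lam h X b d := by
    have e₂ : ctr h (fun a c => X c d b a) = -lam h X b d := by
      rw [hg.ctr_swap fun a c => X a d b c, lam, ← ctr_neg]
      exact ctr_congr fun i j => hX.anti ..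
    have e₃ : ctr h (fun a c => schouten₃ g h Z b c d a - schouten₃ g h Z b d c a) =
        -divCotton g h Z b d := by
      rw [hg.ctr_swap fun a c => schouten₃ g h Z b a d c - schouten₃ g h Z b d a c, divCotton,
        ← ctr_neg]
      exact ctr_congr fun i j => by ring
    simp only [dPot]
    simp only [ctr_add, ctr_const_mul]
    rw [J.ctr_ctr_cycDeriv hg, e₂, e₃]
    ring
  rw [ctr_congr e]
  simp only [ctr_sub, ctr_const_mul, ctr_add, hg.ctr_g, hg.ctr_g_left]
  rw [e₁, ctr_weylOp hg hX hn, hg.ctr_g_right]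
  have q : qHat g h K X Z b d = divCotton g h Z b d + 2 * K * lam h X b d
    + ((n : ℝ) - 4) * K * schouten g h X b d := rfl
  rw [dTrPot]
  linear_combination (2 - (n : ℝ)) * q

theorem ctr_dTrPot (hg : IsInversePair g h) :
    ctr h (fun b d => dTrPot g h K X Z d b) = ctr h (fun i j => divCotton g h Z i j)
      + (2 * (n : ℝ) - 6) * K * scal h X := by
  have e₁ : ctr h (fun b d => ctr h fun a c => ctr h fun i j => cycDeriv₃ Z a c d i j b) = 0 := by
    rw [← J.ctr_ctr_ctr_cycDeriv hg, ← hg.ctr_swap]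
    exact ctr_congr fun d b => ctr_ctr_comm _
  have e₂ : ctr h (fun b d => ctr h fun a c => X c d a b) = scal h X := by
    rw [← hg.ctr_swap, scal]
    exact ctr_congr fun d b => by rw [← hg.ctr_swap]
  have e₃ : ctr h (fun b d => ctr h fun a c => schouten₃ g h Z a c d b - schouten₃ g h Z a d c b) =
      ctr h (fun i j => divCotton g h Z i j) := by
    simp only [divCotton]
    rw [← hg.ctr_swap, ctr_ctr_comm]
  simp only [dTrPot, dPot]
  simp only [ctr_add, ctr_const_mul]
  rw [e₁, e₂, e₃]
  ring

/-- The trace of `divCurl_eq`, solved for the coefficient of the metric: together with the double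
divergence of `W` it is `z_{d;b}` up to terms of first order. -/
theorem divCurl_add_divDiv (hg : IsInversePair g h) (hn : 5 ≤ n) (b d : Fin n) :
    ((n : ℝ) - 3) * qHat g h K X Z b d - divDiv g h Z b d =
      ((n : ℝ) - 4) * K * (2 * lam h X b d - schouten g h X b d
        - g b d * (2 * scal h X / ((n : ℝ) - 1)))
      + dTrPot g h K X Z d b - K * trCycDeriv h X b d := by
  have hX := J.symm_one
  have hn' : (5 : ℝ) ≤ n := by exact_mod_cast hn
  have h1 : (n : ℝ) - 1 ≠ 0 := by linarith
  have h2 : (n : ℝ) - 2 ≠ 0 := by linarith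
  have t := J.ctr_divCurl_eq hg hn
  -- the double divergence of `W` is trace-free, which determines the trace of `qHat`
  have t' := ctr_congr (h := h) fun b d => t b d
  simp only [ctr_sub, ctr_neg, ctr_const_mul, hg.ctr_g] at t'
  rw [J.ctr_divDiv hg hn, J.ctr_dTrPot hg, hg.ctr_antisymm (trCycDeriv_swap hX), ctr_lam hg,
    ctr_schouten hg hX hn] at t'
  have u : ctr h (fun i j => qHat g h K X Z i j) = ((n : ℝ) - 4) * K *
      (2 * scal h X / ((n : ℝ) - 1)) := by
    have u' : ctr h (fun i j => qHat g h K X Z i j) = ctr h (fun i j => divCotton g h Z i j)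
        + 2 * K * scal h X + ((n : ℝ) - 4) * K * (2 * scal h X / ((n : ℝ) - 1)) := by
      simp only [qHat, ctr_add, ctr_const_mul]
      rw [ctr_lam hg, ctr_schouten hg hX hn]
    refine mul_left_cancel₀ (mul_ne_zero two_ne_zero h2) ?_
    have hs : ((n : ℝ) - 1) * (2 * scal h X / ((n : ℝ) - 1)) = 2 * scal h X := by field_simp
    linear_combination t' + ((n : ℝ) - 4) * u' - 2 * ((n : ℝ) - 4) * K * hs
  rw [u] at t
  have := t b d
  simp only [qHat]
  linear_combination this

end JetRelations

end ThirdOrder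

/-! ### The first-order part of the constraint -/

section FirstOrder

variable {n : ℕ} {g h : Matrix (Fin n) (Fin n) ℝ}

/-- The algebraic relations between `A = L_{abc}`, `B = L_{abc;ij}` and `D = L_{abc;ijkl}` in a
space of constant curvature `K`. -/
structure FullJetRelations (g : Matrix (Fin n) (Fin n) ℝ) (K : ℝ)
    (A : Fin n → Fin n → Fin n → ℝ) (B : Fin n → Arr₄ n) (D : Fin n → Arr₆ n) : Prop where
  anti : ∀ a b c, A a b c = -A b a c
  cyc : ∀ a b c, A a b c + A b c a + A c a b = 0
  jet : ∀ e, JetRelations g K (fun a b c d => B a b c d e) (fun a b c d i j => D a b c d i j e)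
  ricci_two : ∀ a b c i j, B a b c i j - B a b c j i =
    K * (g a j * A i b c - g a i * A j b c + g b j * A a i c - g b i * A a j c
      + g c j * A a b i - g c i * A a b j)
  ricci_four : ∀ a b c d e i j, D a b c d e i j - D a b c d e j i =
    K * (g a j * B i b c d e - g a i * B j b c d e + g b j * B a i c d e - g b i * B a j c d e
      + g c j * B a b i d e - g c i * B a b j d e + g d j * B a b c i e - g d i * B a b c j e
      + g e j * B a b c d i - g e i * B a b c d j)

variable {K : ℝ} {A : Fin n → Fin n → Fin n → ℝ} {B : Fin n → Arr₄ n} {D : Fin n → Arr₆ n}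

/-- The array `L_{abc;de}` with `e` fixed. -/
def slice (B : Fin n → Arr₄ n) (e : Fin n) : Arr₄ n := fun a b c d => B a b c d e

/-- The array `L_{abc;dije}` with `e` fixed. -/
def slice₃ (D : Fin n → Arr₆ n) (e : Fin n) : Arr₆ n := fun a b c d i j => D a b c d i j e

/-- `Z_{acd} = H_{acdi;}{}^i + P_{ac;d} - P_{ad;c} + (2n-6) K L_{cda}`. -/
noncomputable def pot (g h : Matrix (Fin n) (Fin n) ℝ) (K : ℝ) (A : Fin n → Fin n → Fin n → ℝ)
    (B : Fin n → Arr₄ n) (a c d : Fin n) : ℝ :=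
  ctr h (fun i j => cycDeriv (slice B j) a c d i)
    + (schouten g h (slice B d) a c - schouten g h (slice B c) a d)
    + (2 * (n : ℝ) - 6) * K * A c d a

/-- `v_b = L_{bi}{}^i`. -/
def vec (h : Matrix (Fin n) (Fin n) ℝ) (A : Fin n → Fin n → Fin n → ℝ) (b : Fin n) : ℝ :=
  ctr h fun i j => A b i j

theorem trCycDeriv_eq (hg : IsInversePair g h) {X : Arr₄ n} (hX : LanczosSymm X) (b d : Fin n) :
    trCycDeriv h X b d = lam h X d b - lam h X b d + dvec h X d b - dvec h X b d := by
  have e : ∀ i j, cycDeriv X i j b d = -X b j i d + (X b i d j - X d i b j) + X d j i b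
      + (X b d i j - (X b i d j - X d i b j)) := by
    intro i j
    simp only [cycDeriv]
    linear_combination hX.anti j b i d
  have e' : ∀ i j, X b d i j - (X b i d j - X d i b j) = 0 := fun i j => by
    linear_combination hX.cyc b d i j - hX.anti i b d j
  rw [trCycDeriv, ctr_congr fun i j => (e i j).trans (by rw [e', add_zero])]
  simp only [ctr_add, ctr_sub, ctr_neg]
  rw [hg.ctr_swap fun i j => X b i j d, hg.ctr_swap fun i j => X d i j b]
  simp only [lam, dvec]
  ring

namespace FullJetRelations

variable (J : FullJetRelations g K A B D)
include J

theorem symm_slice (e : Fin n) : LanczosSymm (slice B e) := (J.jet e).symm_one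

/-- The Ricci identity for `v`. -/
theorem dvec_comm (hg : IsInversePair g h) (d b e : Fin n) :
    dvec h (slice B e) d b - dvec h (slice B b) d e =
      K * (g d e * vec h A b - g d b * vec h A e) := by
  simp only [dvec, slice]
  rw [← ctr_sub, ctr_congr fun i j => J.ricci_two d i j b e]
  simp only [ctr_sub, ctr_const_mul, ctr_add, hg.ctr_g_left', hg.ctr_g_right', vec]
  ring

/-- The divergence of `L_{idb;e} - L_{ide;b}` in its first index. -/
theorem div_right (hg : IsInversePair g h) (b e d : Fin n) :
    ctr h (fun i j => B i d b e j - B i d e b j) =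
      lam h (slice B b) e d - lam h (slice B e) b d - ((n : ℝ) - 3) * K * A b e d := by
  have s := J.anti
  have key : ∀ b e, ctr h (fun i j => B i d b e j) = -lam h (slice B e) b d +
      K * (((n : ℝ) - 1) * A e d b + A d e b + A b d e - g b e * ctr h (fun i j => A i d j)) := by
    intro b e
    have hh : ∀ i j, B i d b e j = -B d i b j e + K * (g i j * A e d b - g i e * A j d b
        + g d j * A i e b - g d e * A i j b + g b j * A i d e - g b e * A i d j) := fun i j => by
      have t : B i d b j e = -B d i b j e := (J.symm_slice e).anti i d b j
      linear_combination J.ricci_two i d b e j + t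
    rw [ctr_congr hh]
    simp only [ctr_sub, ctr_neg, ctr_const_mul, ctr_add, hg.ctr_g, hg.ctr_g_left', hg.ctr_g_right,
      lam, slice]
    rw [hg.ctr_antisymm fun i j => J.anti i j b]
    ring
  rw [ctr_sub, key, key, hg.symm b e]
  linear_combination ((n : ℝ) - 3) * K * (J.cyc b e d - s d b e) + K * s d e b - K * s d b e

/-- The divergence of `λ` contracts `L` with second derivatives in its antisymmetric pair of
indices, hence is a curvature term. -/
theorem lam_div (hg : IsInversePair g h) (e : Fin n) :
    ctr h (fun i j => lam h (slice B j) e i) = K * vec h A e := by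
  have s := J.anti
  have key : ∀ i j k l, B i k e l j + B k i e j l = K * (g i j * A l k e - g i l * A j k e
      + g k j * A i l e - g k l * A i j e + g e j * A i k l - g e l * A i k j) := fun i j k l => by
    have t : B i k e j l = -B k i e j l := (J.symm_slice l).anti i k e j
    linear_combination J.ricci_two i k e l j + t
  have e₁ := ctr_ctr_symmetrize (h := h) (F := fun i j k l => B i k e l j) key
  simp only [ctr_sub, ctr_const_mul, ctr_add, hg.ctr_g, hg.ctr_g_left', hg.ctr_g_right] at e₁
  have t₁ : ctr h (fun i j => A i j e) = 0 := hg.ctr_antisymm fun i j => s i j e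
  have t₂ : ctr h (fun i j => A j i e) = 0 := hg.ctr_antisymm fun i j => s j i e
  have t₃ : ctr h (A · e ·) = -vec h A e := by
    rw [vec, ← ctr_neg]
    exact ctr_congr fun i j => s i e j
  have t₄ : ctr h (A e) = vec h A e := rfl
  rw [t₁, t₂, t₃, t₄] at e₁
  simp only [lam, slice]
  linear_combination e₁ / 2

theorem dvec_div (hg : IsInversePair g h) (e : Fin n) :
    ctr h (fun i j => dvec h (slice B j) i e) =
      -scal h (slice B e) + ((n : ℝ) - 1) * K * vec h A e := by
  have e₁ : ∀ i j, dvec h (slice B j) i e = dvec h (slice B e) i j +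
      K * ctr h (fun k l => g i j * A e k l - g i e * A j k l + g k j * A i e l - g k e * A i j l
        + g l j * A i k e - g l e * A i k j) := fun i j => by
    simp only [dvec, slice]
    rw [← ctr_const_mul, ← ctr_add]
    exact ctr_congr fun k l => by linear_combination J.ricci_two i k l e j
  rw [ctr_congr e₁]
  simp only [ctr_sub, ctr_const_mul, ctr_add, hg.ctr_g, hg.ctr_g_left', hg.ctr_g_right']
  rw [ctr_dvec (J.symm_slice e)]
  simp only [vec]
  ring

/-- The trace `z_e = Z_a{}^a{}_e`. -/
theorem ctr_pot (hg : IsInversePair g h) (hn : 5 ≤ n) (e : Fin n) :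
    ctr h (fun a c => pot g h K A B a c e) = 2 * K * vec h A e
      + ((n : ℝ) - 3) * (ctr h (fun i j => schouten g h (slice B j) e i)
        - 2 * scal h (slice B e) / ((n : ℝ) - 1)) := by
  have hn' : (5 : ℝ) ≤ n := by exact_mod_cast hn
  have h1 : (n : ℝ) - 1 ≠ 0 := by linarith
  set p := ctr h (fun i j => schouten g h (slice B j) e i) with hp
  have e₁ : ctr h (fun a c => ctr h fun i j => cycDeriv (slice B j) a c e i) =
      ctr h (fun i j => lam h (slice B j) i e) - ctr h (fun i j => lam h (slice B j) e i)
      + ctr h (fun i j => dvec h (slice B j) i e) - ctr h (fun i j => dvec h (slice B j) e i) := by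
    rw [ctr_ctr_comm]
    simp only [← ctr_add, ← ctr_sub]
    exact ctr_congr fun i j => trCycDeriv_eq hg (J.symm_slice j) e i
  have e₂ : ctr h (fun a c => A c e a) = -vec h A e := by
    rw [hg.ctr_swap fun a c => A a e c, vec, ← ctr_neg]
    exact ctr_congr fun i j => J.anti ..
  have e₃ : ((n : ℝ) - 2) * p = ctr h (fun i j => lam h (slice B j) e i)
      + ctr h (fun i j => lam h (slice B j) i e) - ctr h (fun i j => dvec h (slice B j) e i)
      - ctr h (fun i j => dvec h (slice B j) i e)
      - 2 * scal h (slice B e) / ((n : ℝ) - 1) := by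
    rw [hp, ← ctr_const_mul, ctr_congr fun i j => (schouten_eq hn (slice B j) e i).trans
      (by rw [mul_comm _ (g e i)])]
    simp only [ctr_sub, ctr_add]
    rw [hg.ctr_g_left e fun j => 2 * scal h (slice B j) / ((n : ℝ) - 1)]
  have e₄ : ctr h (fun a c => schouten g h (slice B c) a e) = p := by
    rw [hp]
    exact ctr_congr fun i j => schouten_symm hg ..
  simp only [pot]
  simp only [ctr_sub, ctr_const_mul, ctr_add]
  rw [e₁, e₂, e₄, ctr_schouten hg (J.symm_slice e) hn]
  rw [J.dvec_div hg] at e₃ ⊢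
  rw [J.lam_div hg] at e₃ ⊢
  have hs : ((n : ℝ) - 1) * (2 * scal h (slice B e) / ((n : ℝ) - 1)) = 2 * scal h (slice B e) := by
    field_simp
  linear_combination hs - e₃

/-- The Ricci identity for the covariant derivative of `P`. -/
theorem schouten_comm (hg : IsInversePair g h) (a c d b e : Fin n) :
    schouten₃ g h (slice₃ D e) a c d b - schouten₃ g h (slice₃ D b) a c d e =
      K * (g a e * schouten g h (slice B d) b c - g a b * schouten g h (slice B d) e c
        + g c e * schouten g h (slice B d) a b - g c b * schouten g h (slice B d) a e
        + g d e * schouten g h (slice B b) a c - g d b * schouten g h (slice B e) a c) := by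
  have e₁ : ∀ a c, lam h (fun p q r s => D p q r s d b e) a c
      - lam h (fun p q r s => D p q r s d e b) a c =
      K * (g a e * lam h (slice B d) b c - g a b * lam h (slice B d) e c
        + g c e * lam h (slice B d) a b - g c b * lam h (slice B d) a e
        + g d e * lam h (slice B b) a c - g d b * lam h (slice B e) a c) := by
    intro a c
    simp only [lam, slice]
    rw [← ctr_sub, ctr_congr fun i j => J.ricci_four c i a j d b e]
    simp only [ctr_sub, ctr_const_mul, ctr_add, hg.ctr_g_left', hg.ctr_g_right']
    ring
  have e₂ : ∀ a c, dvec h (fun p q r s => D p q r s d b e) a c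
      - dvec h (fun p q r s => D p q r s d e b) a c =
      K * (g a e * dvec h (slice B d) b c - g a b * dvec h (slice B d) e c
        + g c e * dvec h (slice B d) a b - g c b * dvec h (slice B d) a e
        + g d e * dvec h (slice B b) a c - g d b * dvec h (slice B e) a c) := by
    intro a c
    simp only [dvec, slice]
    rw [← ctr_sub, ctr_congr fun i j => J.ricci_four a i j c d b e]
    simp only [ctr_sub, ctr_const_mul, ctr_add, hg.ctr_g_left', hg.ctr_g_right']
    ring
  have e₃ : scal h (fun p q r s => D p q r s d b e) - scal h (fun p q r s => D p q r s d e b) =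
      K * (g d e * scal h (slice B b) - g d b * scal h (slice B e)) := by
    rw [← ctr_lam hg, ← ctr_lam hg, ← ctr_sub, ctr_congr e₁]
    simp only [ctr_sub, ctr_const_mul, ctr_add, hg.ctr_g_left', hg.ctr_g_right', ctr_lam hg]
    ring
  simp only [schouten₃, schouten, slice₃]
  linear_combination 1 / ((n : ℝ) - 2) * (e₁ a c + e₁ c a - e₂ a c - e₂ c a)
    - 2 / (((n : ℝ) - 2) * ((n : ℝ) - 1)) * g a c * e₃
    + 2 / (((n : ℝ) - 2) * ((n : ℝ) - 1)) * K * scal h (slice B d) *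
      (g a b * hg.symm c e - g a e * hg.symm c b)

/-- The Ricci identity for the tensor `pot`. -/
theorem pot_comm (hg : IsInversePair g h) (a b c d e : Fin n) :
    dPot g h K (slice B e) (slice₃ D e) a c d b - dPot g h K (slice B b) (slice₃ D b) a c d e =
      K * (g a e * pot g h K A B b c d - g a b * pot g h K A B e c d
        + g c e * pot g h K A B a b d - g c b * pot g h K A B a e d
        + g d e * pot g h K A B a c b - g d b * pot g h K A B a c e) := by
  have hX := J.symm_slice
  have e₁ : ∀ i j, cycDeriv₃ (slice₃ D e) a c d i j b - cycDeriv₃ (slice₃ D b) a c d i j e =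
      K * (g a e * cycDeriv (slice B j) b c d i - g a b * cycDeriv (slice B j) e c d i
        + g c e * cycDeriv (slice B j) a b d i - g c b * cycDeriv (slice B j) a e d i
        + g d e * cycDeriv (slice B j) a c b i - g d b * cycDeriv (slice B j) a c e i
        + g i e * cycDeriv (slice B j) a c d b - g i b * cycDeriv (slice B j) a c d e
        + g j e * cycDeriv (slice B b) a c d i - g j b * cycDeriv (slice B e) a c d i) := by
    intro i j
    simp only [cycDeriv₃, cycDeriv, slice₃, slice]
    linear_combination J.ricci_four c d a i j b e + J.ricci_four d i a c j b e
      + J.ricci_four i c a d j b e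
  have e₁' := ctr_congr (h := h) e₁
  simp only [ctr_sub, ctr_const_mul, ctr_add, hg.ctr_g_left', hg.ctr_g_right'] at e₁'
  have e₂ := J.schouten_comm hg
  simp only [dPot, pot]
  have r : slice B e c d a b - slice B b c d a e = _ := J.ricci_two c d a b e
  linear_combination e₁' + e₂ a c d b e - e₂ a d c b e + (2 * (n : ℝ) - 6) * K * r

/-- The Ricci identity for the trace of `pot`. -/
theorem trPot_comm (hg : IsInversePair g h) (b d e : Fin n) :
    dTrPot g h K (slice B e) (slice₃ D e) d b - dTrPot g h K (slice B b) (slice₃ D b) d e =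
      K * (g d e * ctr h (fun a c => pot g h K A B a c b)
        - g d b * ctr h (fun a c => pot g h K A B a c e)) := by
  simp only [dTrPot]
  rw [← ctr_sub, ctr_congr fun a c => J.pot_comm hg a b c d e]
  simp only [ctr_sub, ctr_const_mul, ctr_add, hg.ctr_g_left', hg.ctr_g_right']
  ring

/-- The identity, of first order in `W`, to which the constraint reduces. -/
theorem pot_antisymm (hg : IsInversePair g h) (hn : 5 ≤ n) (b d e : Fin n) :
    ((n : ℝ) - 3) * (pot g h K A B b e d - pot g h K A B e b d
        - ctr h (fun i j => weylOp g h (slice B j) b e i d)) =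
      ((n : ℝ) - 4) * ((2 * lam h (slice B e) b d - schouten g h (slice B e) b d
          - g b d * (2 * scal h (slice B e) / ((n : ℝ) - 1)))
        - (2 * lam h (slice B b) e d - schouten g h (slice B b) e d
          - g e d * (2 * scal h (slice B b) / ((n : ℝ) - 1))))
      + (g d e * ctr h (fun a c => pot g h K A B a c b)
        - g d b * ctr h (fun a c => pot g h K A B a c e))
      - (trCycDeriv h (slice B e) b d - trCycDeriv h (slice B b) e d) := by
  have hn' : (5 : ℝ) ≤ n := by exact_mod_cast hn
  have h1 : (n : ℝ) - 1 ≠ 0 := by linarith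
  have e₁ : ctr h (fun i j => cycDeriv (slice B j) b e d i)
      - ctr h (fun i j => cycDeriv (slice B j) e b d i) =
      ctr h (fun i j => slice B j b e i d - slice B j b e d i)
        - ctr h (fun i j => B i d b e j - B i d e b j) := by
    rw [← ctr_sub, ← ctr_sub]
    refine ctr_congr fun i j => ?_
    have s := (J.symm_slice j).anti
    have t := (J.symm_slice j).cyc
    simp only [cycDeriv, slice] at *
    linear_combination t b e d i - s b d e i - t b e i d + s e i b d + s d i b e - s d i e b
  have e₂ : ctr h (fun i j => weylOp g h (slice B j) b e i d) =
      ctr h (fun i j => slice B j b e i d - slice B j b e d i)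
        + ctr h (fun i j => B i d b e j - B i d e b j)
        - (schouten g h (slice B b) e d - schouten g h (slice B e) b d
          - g b d * ctr h (fun i j => schouten g h (slice B j) e i)
          + g e d * ctr h (fun i j => schouten g h (slice B j) b i)) := by
    have e : ∀ i j, weylOp g h (slice B j) b e i d = slice B j b e i d - slice B j b e d i
      + (B i d b e j - B i d e b j) - (g b i * schouten g h (slice B j) e d
        - g e i * schouten g h (slice B j) b d - g b d * schouten g h (slice B j) e i
        + g e d * schouten g h (slice B j) b i) := fun i j => by
      simp only [weylOp, slice]; ring
    rw [ctr_congr e]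
    simp only [ctr_sub, ctr_const_mul, ctr_add, hg.ctr_g_left]
  rw [e₂, trCycDeriv_eq hg (J.symm_slice e), trCycDeriv_eq hg (J.symm_slice b),
    J.ctr_pot hg hn, J.ctr_pot hg hn, J.div_right hg]
  rw [J.div_right hg] at e₁
  simp only [pot]
  have hP := fun e => schouten_eq (g := g) (h := h) hn (slice B e)
  have v := J.dvec_comm hg d b e
  rw [hg.symm d b, hg.symm d e] at v ⊢
  linear_combination ((n : ℝ) - 3) * e₁ + hP b e d - hP e b d + 2 * v
    + ((n : ℝ) - 3) * schouten_symm hg (slice B d) b e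
    + 2 * ((n : ℝ) - 3) ^ 2 * K * (J.cyc b e d - J.anti d b e)

end FullJetRelations

end FirstOrder

/-! ### Antisymmetrisation over the first pair and the outer derivative -/

section Assembly

variable {n : ℕ} {g h : Matrix (Fin n) (Fin n) ℝ}
variable {K : ℝ} {A : Fin n → Fin n → Fin n → ℝ} {B : Fin n → Arr₄ n} {D : Fin n → Arr₆ n}

/-- The antisymmetrisation step, for abstract arrays: `E` is the constraint before
antisymmetrisation, `pc` and `tc` are Ricci identities, and `st` is a first-order identity. -/
theorem antisymmetrized_eq_zero (hg : ∀ i j, g i j = g j i) {ν : ℝ}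
    {F₁ F₂ w Zd : Fin n → Fin n → Fin n → Fin n → Fin n → ℝ}
    {V δ Z ζ M H : Fin n → Fin n → Fin n → ℝ} {z : Fin n → ℝ}
    (f₁ : ∀ a b c d e, F₁ a b c d e = -F₁ b a c d e)
    (f₂ : ∀ a b c d e, F₂ a b c d e = -F₂ b a c d e)
    (hw : ∀ a b c d e, w a c b d e - w b c a d e = w a b c d e)
    (E : ∀ a b c d e, (ν - 3) * (F₁ a b c d e + F₂ a b c d e - F₂ a b d c e
        + (ν - 4) * K * w a b c d e)
      + (g a c * δ b d e - g b c * δ a d e - g a d * δ b c e + g b d * δ a c e) =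
      (ν - 3) * (Zd a c d b e - Zd b c d a e)
      - (g a c * ((ν - 4) * K * M b d e + ζ d b e - K * H b d e)
        - g b c * ((ν - 4) * K * M a d e + ζ d a e - K * H a d e)
        - g a d * ((ν - 4) * K * M b c e + ζ c b e - K * H b c e)
        + g b d * ((ν - 4) * K * M a c e + ζ c a e - K * H a c e)))
    (pc : ∀ a b c d e, Zd a c d b e - Zd a c d e b = K * (g a e * Z b c d - g a b * Z e c d
        + g c e * Z a b d - g c b * Z a e d + g d e * Z a c b - g d b * Z a c e))
    (Za : ∀ a c d, Z a c d = -Z a d c)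
    (tc : ∀ b d e, ζ d b e - ζ d e b = K * (g d e * z b - g d b * z e))
    (st : ∀ b d e, (ν - 3) * (Z b e d - Z e b d - (V b e d - V e b d)) =
      (ν - 4) * (M b d e - M e d b) + (g d e * z b - g d b * z e) - (H b d e - H e d b))
    (a b e c d : Fin n) :
    (ν - 3) * (alt₃ (fun a b e => F₁ a b c d e) a b e
      + 2 * alt₃ (fun a b e => alt₂ (fun c d => F₂ a b c d e) c d) a b e
      + 2 * (ν - 4) * K * alt₃ (fun a b e => w a c b d e) a b e
      - 4 * K * alt₃ (fun a b e => alt₂ (fun c d => g a c * V b e d) c d) a b e)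
    + 4 * alt₃ (fun a b e => alt₂ (fun c d => g a c * δ b d e) c d) a b e = 0 := by
  simp only [alt₃, alt₂]
  rw [f₁ b a, f₁ a e, f₁ e b, f₂ b a, f₂ a e, f₂ e b, f₂ b a d, f₂ a e d, f₂ e b d]
  have pc' : ∀ a b c d e, Zd a c d b e - Zd a c d e b = K * (g a e * Z b c d - g a b * Z e c d
      + g e c * Z a b d - g b c * Z a e d - g e d * Z a b c + g b d * Z a e c) := by
    intro a b c d e
    rw [pc, hg c e, hg c b, hg d e, hg d b, Za a c b, Za a c e]
    ring
  linear_combination (E a b c d e + E b e c d a + E e a c d b) / 3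
    + (ν - 3) / 3 * (pc' a b c d e + pc' b e c d a + pc' e a c d b)
    + (ν - 3) / 3 * K * (Z b c d * hg a e + Z e c d * hg b a + Z a c d * hg e b)
    - 1 / 3 * (g a c * tc b d e + g b c * tc e d a + g e c * tc a d b
      - g a d * tc b c e - g b d * tc e c a - g e d * tc a c b)
    + K / 3 * (g a c * st b d e + g b c * st e d a + g e c * st a d b
      - g a d * st b c e - g b d * st e c a - g e d * st a c b)
    + (ν - 3) * (ν - 4) * K / 3 * (hw a b c d e + hw b e c d a + hw e a c d b)

namespace FullJetRelations

variable (J : FullJetRelations g K A B D)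
include J

/-- The constraint with one derivative index singled out, before antisymmetrisation. -/
theorem divCurl_with_trace (hg : IsInversePair g h) (a b c d e : Fin n) :
    ((n : ℝ) - 3) * (divCurl g h (slice₃ D e) a b c d
        + ((n : ℝ) - 4) * K * weylOp g h (slice B e) a b c d)
      + (g a c * divDiv g h (slice₃ D e) b d - g b c * divDiv g h (slice₃ D e) a d
        - g a d * divDiv g h (slice₃ D e) b c + g b d * divDiv g h (slice₃ D e) a c) =
    ((n : ℝ) - 3) * (dPot g h K (slice B e) (slice₃ D e) a c d b
        - dPot g h K (slice B e) (slice₃ D e) b c d a)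
      - (g a c * (((n : ℝ) - 3) * qHat g h K (slice B e) (slice₃ D e) b d
            - divDiv g h (slice₃ D e) b d)
        - g b c * (((n : ℝ) - 3) * qHat g h K (slice B e) (slice₃ D e) a d
            - divDiv g h (slice₃ D e) a d)
        - g a d * (((n : ℝ) - 3) * qHat g h K (slice B e) (slice₃ D e) b c
            - divDiv g h (slice₃ D e) b c)
        + g b d * (((n : ℝ) - 3) * qHat g h K (slice B e) (slice₃ D e) a c
            - divDiv g h (slice₃ D e) a c)) := by
  have J' : JetRelations g K (slice B e) (slice₃ D e) := J.jet e
  linear_combination ((n : ℝ) - 3) * J'.divCurl_eq hg a b c d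

/-- The jet of a Lanczos potential satisfies the constraint, multiplied by `n - 3` and with the
scalar curvature expressed by `K`. -/
theorem constraint_eq_zero (hg : IsInversePair g h) (hn : 5 ≤ n) (a b e c d : Fin n) :
    ((n : ℝ) - 3) * (alt₃ (fun a b e => ctr h fun i j =>
        weylOp g h (fun p q r s => D p q r s i j e) a b c d) a b e
      + 2 * alt₃ (fun a b e => alt₂ (fun c d => ctr h fun i j =>
        weylOp g h (fun p q r s => D p q r s d j e) a b i c) c d) a b e
      + 2 * ((n : ℝ) - 4) * K * alt₃ (fun a b e => weylOp g h (slice B e) a c b d) a b e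
      - 4 * K * alt₃ (fun a b e => alt₂ (fun c d => g a c *
          ctr h fun i j => weylOp g h (slice B j) b i e d) c d) a b e)
    + 4 * alt₃ (fun a b e => alt₂ (fun c d => g a c * divDiv g h (slice₃ D e) b d) c d) a b e
      = 0 := by
  have hW := J.symm_slice
  have hD : ∀ i j e, LanczosSymm fun p q r s => D p q r s i j e := fun i j e =>
    (J.jet e).symm_three i j
  have f₁ : ∀ a b c d e, (ctr h fun i j => weylOp g h (fun p q r s => D p q r s i j e) a b c d) =
      -(ctr h fun i j => weylOp g h (fun p q r s => D p q r s i j e) b a c d) := by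
    intro a b c d e
    rw [← ctr_neg]
    exact ctr_congr fun i j => weylOp_anti_left (hD i j e) ..
  have f₂ : ∀ a b c d e, (ctr h fun i j => weylOp g h (fun p q r s => D p q r s d j e) a b i c) =
      -(ctr h fun i j => weylOp g h (fun p q r s => D p q r s d j e) b a i c) := by
    intro a b c d e
    rw [← ctr_neg]
    exact ctr_congr fun i j => weylOp_anti_left (hD d j e) ..
  have f₃ : ∀ a b c d e, divCurl g h (slice₃ D e) a b c d =
      (ctr h fun i j => weylOp g h (fun p q r s => D p q r s i j e) a b c d)
      + (ctr h fun i j => weylOp g h (fun p q r s => D p q r s d j e) a b i c)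
      - (ctr h fun i j => weylOp g h (fun p q r s => D p q r s c j e) a b i d) := by
    intro a b c d e
    rw [divCurl, ← ctr_add, ← ctr_sub]
    exact ctr_congr fun i j => by
      have := weylOp_anti_right (g := g) (h := h) ((J.jet e).symm_three c j) a b d i
      simp only [slice₃]
      linear_combination this
  have f₄ : ∀ a b c d e, weylOp g h (slice B e) a c b d - weylOp g h (slice B e) b c a d =
      weylOp g h (slice B e) a b c d := fun a b c d e => weylOp_cyclic hg (hW e) ..
  have f₅ : ∀ b e d, (ctr h fun i j => weylOp g h (slice B j) b i e d)
      - (ctr h fun i j => weylOp g h (slice B j) e i b d) =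
      ctr h fun i j => weylOp g h (slice B j) b e i d := by
    intro b e d
    rw [← ctr_sub]
    exact ctr_congr fun i j => weylOp_cyclic hg (hW j) ..
  have E := J.divCurl_with_trace hg
  have X : ∀ e b d, ((n : ℝ) - 3) * qHat g h K (slice B e) (slice₃ D e) b d
      - divDiv g h (slice₃ D e) b d = _ := fun e b d =>
    (J.jet e).divCurl_add_divDiv hg hn b d
  simp only [X, f₃] at E
  have st := J.pot_antisymm hg hn
  simp only [← f₅] at st
  have Za : ∀ a c d, pot g h K A B a c d = -pot g h K A B a d c := by
    intro a c d
    have e : (ctr h fun i j => cycDeriv (slice B j) a c d i) =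
        -(ctr h fun i j => cycDeriv (slice B j) a d c i) := by
      rw [← ctr_neg]
      exact ctr_congr fun i j => cycDeriv_swap (hW j) ..
    simp only [pot]
    rw [e, J.anti c d a]
    ring
  exact antisymmetrized_eq_zero hg.symm
    (Zd := fun a c d b e => dPot g h K (slice B e) (slice₃ D e) a c d b)
    (w := fun a b c d e => weylOp g h (slice B e) a b c d) f₁ f₂ f₄ E
    (J.pot_comm hg) Za (J.trPot_comm hg) st a b e c d

end FullJetRelations

end Assembly

/-! ### Partial derivatives -/

section Calculus

variable {n : ℕ} {U : Set (Coord n)} {f f' : Coord n → ℝ} {y : Coord n}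

theorem pd_congr (hU : IsOpen U) (hy : y ∈ U) (H : ∀ z ∈ U, f z = f' z) (i : Fin n) :
    pd i f y = pd i f' y := by
  have : f =ᶠ[nhds y] f' := Filter.eventuallyEq_of_mem (hU.mem_nhds hy) H
  simp only [pd, this.fderiv_eq]

theorem pd_const (c : ℝ) (i : Fin n) : pd i (fun _ => c) y = 0 := by simp [pd]

theorem pd_add (hf : DifferentiableAt ℝ f y) (hf' : DifferentiableAt ℝ f' y) (i : Fin n) :
    pd i (fun z => f z + f' z) y = pd i f y + pd i f' y := by
  have : fderiv ℝ (fun z => f z + f' z) y = fderiv ℝ f y + fderiv ℝ f' y := fderiv_add hf hf'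
  simp [pd, this]

theorem pd_sub (hf : DifferentiableAt ℝ f y) (hf' : DifferentiableAt ℝ f' y) (i : Fin n) :
    pd i (fun z => f z - f' z) y = pd i f y - pd i f' y := by
  have : fderiv ℝ (fun z => f z - f' z) y = fderiv ℝ f y - fderiv ℝ f' y := fderiv_sub hf hf'
  simp [pd, this]

theorem pd_mul (hf : DifferentiableAt ℝ f y) (hf' : DifferentiableAt ℝ f' y) (i : Fin n) :
    pd i (fun z => f z * f' z) y = f y * pd i f' y + f' y * pd i f y := by
  have : fderiv ℝ (fun z => f z * f' z) y = f y • fderiv ℝ f' y + f' y • fderiv ℝ f y :=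
    fderiv_mul hf hf'
  simp [pd, this]

theorem pd_const_mul (hf : DifferentiableAt ℝ f y) (c : ℝ) (i : Fin n) :
    pd i (fun z => c * f z) y = c * pd i f y := by
  rw [pd_mul (differentiableAt_const c) hf, pd_const, mul_zero, add_zero]

theorem pd_sum {ι : Type*} (s : Finset ι) {F : ι → Coord n → ℝ}
    (hF : ∀ a ∈ s, DifferentiableAt ℝ (F a) y) (i : Fin n) :
    pd i (fun z => ∑ a ∈ s, F a z) y = ∑ a ∈ s, pd i (F a) y := by
  simp only [pd]
  rw [fderiv_fun_sum hF]
  simp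

/-- Partial derivatives of a twice differentiable function commute. -/
theorem pd_comm (hU : IsOpen U) (hf : DifferentiableOn ℝ f U)
    (hf' : ∀ i, DifferentiableOn ℝ (pd i f) U) (hy : y ∈ U) (i j : Fin n) :
    pd j (pd i f) y = pd i (pd j f) y := by
  let F' : Coord n → Coord n →L[ℝ] ℝ := fun z =>
    ∑ i, pd i f z • (EuclideanSpace.proj i : Coord n →L[ℝ] ℝ)
  let F'' : Coord n →L[ℝ] Coord n →L[ℝ] ℝ :=
    ∑ i, (fderiv ℝ (pd i f) y).smulRight (EuclideanSpace.proj i : Coord n →L[ℝ] ℝ)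
  have h₁ : ∀ᶠ z in nhds y, HasFDerivAt f (F' z) z := by
    filter_upwards [hU.mem_nhds hy] with z hz
    have hd := ((hf z hz).differentiableAt (hU.mem_nhds hz)).hasFDerivAt
    have : fderiv ℝ f z = F' z := by
      apply ContinuousLinearMap.coe_injective
      refine (EuclideanSpace.basisFun (Fin n) ℝ).toBasis.ext fun k => ?_
      simp [F', pd, PiLp.single_apply]
    rwa [← this]
  have h₂ : HasFDerivAt F' F'' y := by
    refine HasFDerivAt.fun_sum fun i _ => ?_
    exact (((hf' i y hy).differentiableAt (hU.mem_nhds hy)).hasFDerivAt).smul_const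
      (EuclideanSpace.proj i : Coord n →L[ℝ] ℝ)
  have h₃ := second_derivative_symmetric_of_eventually h₁ h₂
    (EuclideanSpace.single i 1) (EuclideanSpace.single j 1)
  simp [F'', PiLp.single_apply] at h₃
  exact h₃.symm

namespace TimesDifferentiableOn

theorem congr (hU : IsOpen U) {k : ℕ} (hf : TimesDifferentiableOn k f U)
    (H : ∀ z ∈ U, f' z = f z) : TimesDifferentiableOn k f' U := by
  induction k generalizing f f' with
  | zero => trivial
  | succ k ih =>
    exact ⟨hf.1.congr H, fun i => ih (hf.2 i) fun z hz => pd_congr hU hz H i⟩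

theorem of_succ {k : ℕ} (hf : TimesDifferentiableOn (k + 1) f U) :
    TimesDifferentiableOn k f U := by
  induction k generalizing f with
  | zero => trivial
  | succ k ih => exact ⟨hf.1, fun i => ih (hf.2 i)⟩

theorem of_contDiffOn (hU : IsOpen U) (hf : ContDiffOn ℝ ∞ f U) (k : ℕ) :
    TimesDifferentiableOn k f U := by
  induction k generalizing f with
  | zero => trivial
  | succ k ih =>
    refine ⟨hf.differentiableOn (by simp), fun i => ih ?_⟩
    have := ((contDiffOn_infty_iff_fderiv_of_isOpen hU).1 hf).2
    exact this.clm_apply contDiffOn_const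

theorem add (hU : IsOpen U) {k : ℕ} (hf : TimesDifferentiableOn k f U)
    (hf' : TimesDifferentiableOn k f' U) : TimesDifferentiableOn k (fun z => f z + f' z) U := by
  induction k generalizing f f' with
  | zero => trivial
  | succ k ih =>
    refine ⟨hf.1.add hf'.1, fun i => (ih (hf.2 i) (hf'.2 i)).congr hU fun z hz => ?_⟩
    exact pd_add ((hf.1 z hz).differentiableAt (hU.mem_nhds hz))
      ((hf'.1 z hz).differentiableAt (hU.mem_nhds hz)) i

theorem mul (hU : IsOpen U) {k : ℕ} (hf : TimesDifferentiableOn k f U)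
    (hf' : TimesDifferentiableOn k f' U) : TimesDifferentiableOn k (fun z => f z * f' z) U := by
  induction k generalizing f f' with
  | zero => trivial
  | succ k ih =>
    refine ⟨hf.1.mul hf'.1, fun i => (((ih hf.of_succ (hf'.2 i)).add hU
      (ih hf'.of_succ (hf.2 i)))).congr hU fun z hz => ?_⟩
    exact pd_mul ((hf.1 z hz).differentiableAt (hU.mem_nhds hz))
      ((hf'.1 z hz).differentiableAt (hU.mem_nhds hz)) i

theorem const (hU : IsOpen U) (k : ℕ) (c : ℝ) :
    TimesDifferentiableOn k (fun _ : Coord n => c) U := of_contDiffOn hU contDiffOn_const k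

theorem sub (hU : IsOpen U) {k : ℕ} (hf : TimesDifferentiableOn k f U)
    (hf' : TimesDifferentiableOn k f' U) : TimesDifferentiableOn k (fun z => f z - f' z) U :=
  (hf.add hU ((const hU k (-1)).mul hU hf')).congr hU fun z _ => by ring

theorem sum (hU : IsOpen U) {k : ℕ} {ι : Type*} (s : Finset ι) {F : ι → Coord n → ℝ}
    (hF : ∀ a, TimesDifferentiableOn k (F a) U) :
    TimesDifferentiableOn k (fun z => ∑ a ∈ s, F a z) U := by
  classical
  induction s using Finset.induction_on with
  | empty => simpa using const hU k 0
  | insert a s ha ih => simpa [Finset.sum_insert ha] using (hF a).add hU ih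

end TimesDifferentiableOn

end Calculus

/-! ### The Levi-Civita connection in a chart -/

section Connection

variable {n : ℕ} {G : Coord n → Matrix (Fin n) (Fin n) ℝ} {U : Set (Coord n)}

/-- `G` is the Gram matrix of a smooth pseudo-Riemannian metric on the open set `U`. -/
structure IsLocalMetric (G : Coord n → Matrix (Fin n) (Fin n) ℝ) (U : Set (Coord n)) : Prop where
  isOpen : IsOpen U
  smooth : ∀ a b, ContDiffOn ℝ ∞ (fun y => G y a b) U
  symm : ∀ y ∈ U, ∀ a b, G y a b = G y b a
  isUnit : ∀ y ∈ U, IsUnit (G y).det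

/-- All components of the tensor field are differentiable. -/
def DiffOn {k : ℕ} (T : Comp n k) (U : Set (Coord n)) : Prop := ∀ I, DifferentiableOn ℝ (T I) U

theorem nabla_snoc {k : ℕ} (T : Comp n k) (J : Fin k → Fin n) (e : Fin n) (y : Coord n) :
    nabla G T (Fin.snoc (α := fun _ => Fin n) J e) y = pd e (T J) y
      - ∑ s, ∑ m, christoffel G m e (J s) y * T (Function.update J s m) y := by
  simp [nabla]

namespace IsLocalMetric

variable (hG : IsLocalMetric G U)
include hG

theorem differentiableAt {f : Coord n → ℝ} (hf : DifferentiableOn ℝ f U) {y : Coord n}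
    (hy : y ∈ U) : DifferentiableAt ℝ f y :=
  (hf y hy).differentiableAt (hG.isOpen.mem_nhds hy)

theorem isInversePair {y : Coord n} (hy : y ∈ U) : IsInversePair (G y) (G y)⁻¹ where
  symm := hG.symm y hy
  symm_inv i j := by
    have : (G y).transpose = G y := by ext a b; exact hG.symm y hy b a
    conv_lhs => rw [← this, ← Matrix.transpose_nonsing_inv]
    rfl
  mul_inv a b := by
    have := congrFun₂ (Matrix.mul_nonsing_inv (G y) (hG.isUnit y hy)) a b
    simpa [Matrix.mul_apply, Matrix.one_apply] using this

theorem smooth_inv (i j : Fin n) : ContDiffOn ℝ ∞ (fun y => (G y)⁻¹ i j) U := by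
  have hdet : ∀ H : Coord n → Matrix (Fin n) (Fin n) ℝ,
      (∀ a b, ContDiffOn ℝ ∞ (fun y => H y a b) U) → ContDiffOn ℝ ∞ (fun y => (H y).det) U := by
    intro H hH
    simp only [Matrix.det_apply]
    exact ContDiffOn.sum fun σ _ => (contDiffOn_prod fun i _ => hH _ _).const_smul _
  have e : ∀ y ∈ U, (G y)⁻¹ i j = ((G y).det)⁻¹ * (G y).adjugate i j := by
    intro y _
    simp [Matrix.inv_def]
  refine ContDiffOn.congr (ContDiffOn.mul ((hdet G hG.smooth).inv fun y hy => ?_) ?_) e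
  · exact (hG.isUnit y hy).ne_zero
  · simp only [Matrix.adjugate_apply]
    refine hdet _ fun a b => ?_
    by_cases h : a = j
    · subst h
      simp only [Matrix.updateRow_self]
      exact contDiffOn_const
    · simp only [Matrix.updateRow_ne h]
      exact hG.smooth a b

theorem smooth_pd {f : Coord n → ℝ} (hf : ContDiffOn ℝ ∞ f U) (i : Fin n) :
    ContDiffOn ℝ ∞ (pd i f) U :=
  ((contDiffOn_infty_iff_fderiv_of_isOpen hG.isOpen).1 hf).2.clm_apply contDiffOn_const

theorem smooth_christoffel (m i j : Fin n) : ContDiffOn ℝ ∞ (christoffel G m i j) U := by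
  unfold christoffel
  refine ContDiffOn.sum fun l _ => ContDiffOn.div_const ((hG.smooth_inv m l).mul ?_) 2
  exact ((hG.smooth_pd (hG.smooth l j) i).add (hG.smooth_pd (hG.smooth l i) j)).sub
    (hG.smooth_pd (hG.smooth i j) l)

theorem christoffel_symm {y : Coord n} (hy : y ∈ U) (m i j : Fin n) :
    christoffel G m i j y = christoffel G m j i y := by
  unfold christoffel
  refine Finset.sum_congr rfl fun l _ => ?_
  rw [pd_congr hG.isOpen hy fun z hz => hG.symm z hz i j]
  ring

theorem christoffel_low {y : Coord n} (hy : y ∈ U) (e a b : Fin n) :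
    ∑ m, christoffel G m e a y * G y m b =
      (pd e (fun z => G z b a) y + pd a (fun z => G z b e) y - pd b (fun z => G z e a) y) / 2 := by
  have hI := hG.isInversePair hy
  simp only [christoffel, Finset.sum_mul]
  rw [Finset.sum_comm]
  have : ∀ l, ∑ m, (G y)⁻¹ m l * (pd e (fun z => G z l a) y + pd a (fun z => G z l e) y
      - pd l (fun z => G z e a) y) / 2 * G y m b = (if b = l then 1 else 0) *
      ((pd e (fun z => G z l a) y + pd a (fun z => G z l e) y
        - pd l (fun z => G z e a) y) / 2) := by
    intro l
    rw [← hI.mul_inv, Finset.sum_mul]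
    exact Finset.sum_congr rfl fun m _ => by rw [hI.symm b m]; ring
  simp [this]

theorem riemann_eq_sum_riemannLow {y : Coord n} (hy : y ∈ U) (m b c d : Fin n) :
    riemann G m b c d y = ∑ a, (G y)⁻¹ m a * riemannLow G a b c d y := by
  simp only [riemannLow, Finset.mul_sum]
  rw [Finset.sum_comm]
  simp only [← mul_assoc, ← Finset.sum_mul, (hG.isInversePair hy).inv_mul]
  simp

/-- The metric is parallel. -/
theorem pd_metric {y : Coord n} (hy : y ∈ U) (e a b : Fin n) :
    pd e (fun z => G z a b) y = ∑ m, christoffel G m e a y * G y m b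
      + ∑ m, christoffel G m e b y * G y a m := by
  have h2 : ∑ m, christoffel G m e b y * G y a m = ∑ m, christoffel G m e b y * G y m a :=
    Finset.sum_congr rfl fun m _ => by rw [hG.symm y hy a m]
  rw [h2, hG.christoffel_low hy, hG.christoffel_low hy]
  have s := fun i a b => pd_congr hG.isOpen hy (fun z hz => hG.symm z hz a b) i
  rw [s e b a, s b e a, s a b e]
  ring

/-- The inverse metric is parallel. -/
theorem pd_inv {y : Coord n} (hy : y ∈ U) (e i j : Fin n) :
    pd e (fun z => (G z)⁻¹ i j) y = -∑ m, christoffel G i e m y * (G y)⁻¹ m j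
      - ∑ m, christoffel G j e m y * (G y)⁻¹ i m := by
  have hI := hG.isInversePair hy
  let dh : Matrix (Fin n) (Fin n) ℝ := Matrix.of fun i j => pd e (fun z => (G z)⁻¹ i j) y
  let dg : Matrix (Fin n) (Fin n) ℝ := Matrix.of fun i j => pd e (fun z => G z i j) y
  let C : Matrix (Fin n) (Fin n) ℝ := Matrix.of fun p m => christoffel G p e m y
  have h₁ : dg = C.transpose * G y + G y * C := by
    ext a b
    simp only [dg, C, Matrix.of_apply, Matrix.add_apply, Matrix.mul_apply, Matrix.transpose_apply]
    rw [hG.pd_metric hy]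
    congr 1
    exact Finset.sum_congr rfl fun m _ => mul_comm _ _
  have dG := fun a b => hG.differentiableAt ((hG.smooth a b).differentiableOn (by simp)) hy
  have dH := fun a b => hG.differentiableAt ((hG.smooth_inv a b).differentiableOn (by simp)) hy
  have h₂ : dh * G y + (G y)⁻¹ * dg = 0 := by
    ext a b
    have : pd e (fun z => ∑ m, (G z)⁻¹ a m * G z m b) y = 0 := by
      rw [pd_congr hG.isOpen hy (f' := fun _ => (1 : Matrix (Fin n) (Fin n) ℝ) a b) fun z hz => by
        rw [← Matrix.nonsing_inv_mul (G z) (hG.isUnit z hz), Matrix.mul_apply], pd_const]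
    rw [pd_sum (F := fun m z => (G z)⁻¹ a m * G z m b) _
      fun m _ => (dH a m).fun_mul (dG m b)] at this
    simp only [pd_mul (dH _ _) (dG _ _), Finset.sum_add_distrib] at this
    simp only [dh, dg, Matrix.add_apply, Matrix.mul_apply, Matrix.of_apply, Matrix.zero_apply]
    rw [← this, add_comm]
    congr 1
    exact Finset.sum_congr rfl fun m _ => mul_comm _ _
  have u := hG.isUnit y hy
  have h₃ : dh = -((G y)⁻¹ * C.transpose + C * (G y)⁻¹) := by
    calc dh = dh * G y * (G y)⁻¹ := by rw [Matrix.mul_assoc, Matrix.mul_nonsing_inv _ u, mul_one]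
      _ = -((G y)⁻¹ * dg) * (G y)⁻¹ := by rw [eq_neg_of_add_eq_zero_left h₂]
      _ = -((G y)⁻¹ * C.transpose * (G y * (G y)⁻¹) + (G y)⁻¹ * G y * C * (G y)⁻¹) := by
          rw [h₁]; noncomm_ring
      _ = _ := by rw [Matrix.mul_nonsing_inv _ u, Matrix.nonsing_inv_mul _ u, mul_one, one_mul]
  have := congrFun₂ h₃ i j
  simp only [dh, C, Matrix.of_apply, Matrix.neg_apply, Matrix.add_apply, Matrix.mul_apply,
    Matrix.transpose_apply] at this
  rw [this, neg_add, sub_eq_add_neg, add_comm]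
  congr 2
  exact Finset.sum_congr rfl fun m _ => mul_comm _ _

end IsLocalMetric

end Connection

/-! ### Parallel index operations -/

section Parallel

variable {n k l m : ℕ} {G : Coord n → Matrix (Fin n) (Fin n) ℝ} {U : Set (Coord n)}

/-- An operation that turns an array with `k` indices into one with `l` indices, depending on the
point. -/
abbrev IndexOp (n k l : ℕ) := Coord n → ((Fin k → Fin n) → ℝ) → (Fin l → Fin n) → ℝ

/-- The pointwise action of an index operation on a tensor field. -/
def IndexOp.app (Φ : IndexOp n k l) (T : Comp n k) : Comp n l := fun J y => Φ y (fun I => T I y) J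

/-- The extension of an index operation to arrays with a further last index, on which it does not
act. -/
def IndexOp.passive (Φ : IndexOp n k l) : IndexOp n (k + 1) (l + 1) := fun y X J =>
  Φ y (fun I => X (Fin.snoc (α := fun _ => Fin n) I (J (Fin.last l)))) (Fin.init J)

/-- A linear index operation is parallel if it commutes with covariant differentiation. -/
structure IsParallel (G : Coord n → Matrix (Fin n) (Fin n) ℝ) (U : Set (Coord n))
    (Φ : IndexOp n k l) : Prop where
  map_add : ∀ y X X' J, Φ y (fun I => X I + X' I) J = Φ y X J + Φ y X' J
  map_smul : ∀ y (c : ℝ) X J, Φ y (fun I => c * X I) J = c * Φ y X J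
  times : ∀ (r : ℕ) (T : Comp n k), (∀ I, TimesDifferentiableOn r (T I) U) →
    ∀ J, TimesDifferentiableOn r (Φ.app T J) U
  nabla_app : ∀ T : Comp n k, DiffOn T U → ∀ y ∈ U, ∀ J e,
    nabla G (Φ.app T) (Fin.snoc (α := fun _ => Fin n) J e) y =
      Φ y (fun I => nabla G T (Fin.snoc (α := fun _ => Fin n) I e) y) J

theorem nabla_snoc_snoc (T : Comp n (k + 1)) (I : Fin k → Fin n) (i e : Fin n) (y : Coord n) :
    nabla G T (Fin.snoc (α := fun _ => Fin n) (Fin.snoc (α := fun _ => Fin n) I i) e) y =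
      nabla G (fun I => T (Fin.snoc (α := fun _ => Fin n) I i))
        (Fin.snoc (α := fun _ => Fin n) I e) y
      - ∑ m, christoffel G m e i y * T (Fin.snoc (α := fun _ => Fin n) I m) y := by
  rw [nabla_snoc, nabla_snoc, Fin.sum_univ_castSucc]
  simp only [Fin.snoc_castSucc, Fin.snoc_last, Fin.update_snoc_last, Fin.snoc_update]
  ring

namespace IsParallel

variable {Φ : IndexOp n k l}

theorem map_sum (hΦ : IsParallel G U Φ) {ι : Type*} (s : Finset ι) (y : Coord n)
    (X : ι → (Fin k → Fin n) → ℝ) (J : Fin l → Fin n) :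
    Φ y (fun I => ∑ a ∈ s, X a I) J = ∑ a ∈ s, Φ y (X a) J := by
  classical
  induction s using Finset.induction_on with
  | empty => simpa using hΦ.map_smul y 0 (fun _ => 0) J
  | insert a s ha ih =>
    simp only [Finset.sum_insert ha]
    rw [hΦ.map_add, ih]

theorem map_sub (hΦ : IsParallel G U Φ) (y : Coord n) (X X' : (Fin k → Fin n) → ℝ)
    (J : Fin l → Fin n) : Φ y (fun I => X I - X' I) J = Φ y X J - Φ y X' J := by
  have := hΦ.map_add y X (fun I => (-1) * X' I) J
  rw [hΦ.map_smul] at this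
  simpa [← sub_eq_add_neg] using this

theorem diffOn (hΦ : IsParallel G U Φ) {T : Comp n k} (hT : DiffOn T U) : DiffOn (Φ.app T) U :=
  fun J => (hΦ.times 1 T (fun I => ⟨hT I, fun _ => trivial⟩) J).1

theorem comp {Ψ : IndexOp n l m} (hΨ : IsParallel G U Ψ)
    (hΦ : IsParallel G U Φ) : IsParallel G U (fun y X => Ψ y (Φ y X)) where
  map_add y X X' J := by
    rw [← hΨ.map_add]; congr 1; funext I; exact hΦ.map_add ..
  map_smul y c X J := by
    rw [← hΨ.map_smul]; congr 1; funext I; exact hΦ.map_smul ..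
  times r T hT J := hΨ.times r _ (hΦ.times r T hT) J
  nabla_app T hT y hy J e := by
    have := hΨ.nabla_app _ (hΦ.diffOn hT) y hy J e
    simp only [hΦ.nabla_app T hT y hy] at this
    exact this

theorem add (hG : IsLocalMetric G U) {Φ' : IndexOp n k l} (hΦ : IsParallel G U Φ)
    (hΦ' : IsParallel G U Φ') : IsParallel G U (fun y X J => Φ y X J + Φ' y X J) where
  map_add y X X' J := by rw [hΦ.map_add, hΦ'.map_add]; ring
  map_smul y c X J := by rw [hΦ.map_smul, hΦ'.map_smul]; ring
  times r T hT J := (hΦ.times r T hT J).add hG.isOpen (hΦ'.times r T hT J)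
  nabla_app T hT y hy J e := by
    rw [← hΦ.nabla_app T hT y hy, ← hΦ'.nabla_app T hT y hy]
    simp only [nabla_snoc]
    have : pd e (IndexOp.app (fun y X J => Φ y X J + Φ' y X J) T J) y =
        pd e (Φ.app T J) y + pd e (Φ'.app T J) y :=
      pd_add (hG.differentiableAt (hΦ.diffOn hT J) hy) (hG.differentiableAt (hΦ'.diffOn hT J) hy) e
    rw [this]
    simp only [IndexOp.app, mul_add, Finset.sum_add_distrib]
    ring

theorem const_mul (hG : IsLocalMetric G U) (hΦ : IsParallel G U Φ) (c : ℝ) :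
    IsParallel G U (fun y X J => c * Φ y X J) where
  map_add y X X' J := by rw [hΦ.map_add]; ring
  map_smul y d X J := by rw [hΦ.map_smul]; ring
  times r T hT J := (TimesDifferentiableOn.const hG.isOpen r c).mul hG.isOpen (hΦ.times r T hT J)
  nabla_app T hT y hy J e := by
    rw [← hΦ.nabla_app T hT y hy]
    simp only [nabla_snoc]
    have : pd e (IndexOp.app (fun y X J => c * Φ y X J) T J) y = c * pd e (Φ.app T J) y :=
      pd_const_mul (hG.differentiableAt (hΦ.diffOn hT J) hy) c e
    rw [this, mul_sub]
    simp only [IndexOp.app, Finset.mul_sum]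
    congr 1
    exact Finset.sum_congr rfl fun s _ => Finset.sum_congr rfl fun m _ => by ring

theorem sub (hG : IsLocalMetric G U) {Φ' : IndexOp n k l} (hΦ : IsParallel G U Φ)
    (hΦ' : IsParallel G U Φ') : IsParallel G U (fun y X J => Φ y X J - Φ' y X J) := by
  simpa [← sub_eq_add_neg] using hΦ.add hG (hΦ'.const_mul hG (-1))

theorem passive (hΦ : IsParallel G U Φ) : IsParallel G U Φ.passive where
  map_add y X X' J := hΦ.map_add ..
  map_smul y c X J := hΦ.map_smul ..
  times r T hT J := hΦ.times r (fun I => T (Fin.snoc (α := fun _ => Fin n) I (J (Fin.last l))))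
    (fun I => hT _) (Fin.init J)
  nabla_app T hT y hy J e := by
    obtain ⟨J, i, rfl⟩ : ∃ J' i, J = Fin.snoc (α := fun _ => Fin n) J' i :=
      ⟨Fin.init J, J (Fin.last l), (Fin.snoc_init_self J).symm⟩
    have e₁ : ∀ J i, Φ.passive.app T (Fin.snoc (α := fun _ => Fin n) J i) =
        Φ.app (fun I => T (Fin.snoc (α := fun _ => Fin n) I i)) J := by
      intro J i; funext y; simp [IndexOp.app, IndexOp.passive]
    rw [nabla_snoc_snoc]
    simp only [e₁]
    rw [hΦ.nabla_app _ (fun I => hT _) y hy]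
    simp only [IndexOp.passive, Fin.snoc_last, Fin.init_snoc, nabla_snoc_snoc]
    rw [hΦ.map_sub, hΦ.map_sum]
    simp only [hΦ.map_smul]
    rfl

/-- An identity between images under parallel operations may be differentiated. -/
theorem transfer (hG : IsLocalMetric G U) {Ψ : IndexOp n m l} (hΦ : IsParallel G U Φ)
    (hΨ : IsParallel G U Ψ) {S : Comp n k} {T : Comp n m} (hS : DiffOn S U) (hT : DiffOn T U)
    (H : ∀ y ∈ U, ∀ J, Φ.app S J y = Ψ.app T J y) :
    ∀ y ∈ U, ∀ J, Φ.passive.app (nabla G S) J y = Ψ.passive.app (nabla G T) J y := by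
  intro y hy J
  have e : ∀ y ∈ U, ∀ J, nabla G (Φ.app S) J y = nabla G (Ψ.app T) J y := by
    intro y hy J
    simp only [nabla]
    rw [pd_congr hG.isOpen hy (fun z hz => H z hz (Fin.init J))]
    congr 1
    exact Finset.sum_congr rfl fun s _ => Finset.sum_congr rfl fun m _ => by rw [H y hy]
  obtain ⟨J, i, rfl⟩ : ∃ J' i, J = Fin.snoc (α := fun _ => Fin n) J' i :=
    ⟨Fin.init J, J (Fin.last l), (Fin.snoc_init_self J).symm⟩
  have := e y hy (Fin.snoc (α := fun _ => Fin n) J i)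
  rw [hΦ.nabla_app S hS y hy, hΨ.nabla_app T hT y hy] at this
  simpa [IndexOp.app, IndexOp.passive] using this

theorem permute {σ : Fin k → Fin k} (hσ : Function.Bijective σ) :
    IsParallel G U (fun _ X J => X (fun s => J (σ s)) : IndexOp n k k) where
  map_add y X X' J := rfl
  map_smul y c X J := rfl
  times r T hT J := hT _
  nabla_app T hT y hy J e := by
    simp only [nabla_snoc]
    congr 1
    rw [← hσ.sum_comp]
    refine Finset.sum_congr rfl fun s _ => Finset.sum_congr rfl fun m _ => ?_
    simp only [IndexOp.app]
    congr 2
    exact Function.update_comp_eq_of_injective J hσ.injective s m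

theorem metric_mul (hG : IsLocalMetric G U) :
    IsParallel G U (fun y X J => G y (J 0) (J 1) * X (fun s => J s.succ.succ) :
      IndexOp n k (k + 2)) where
  map_add y X X' J := mul_add ..
  map_smul y c X J := by ring
  times r T hT J := (TimesDifferentiableOn.of_contDiffOn hG.isOpen (hG.smooth _ _) r).mul
    hG.isOpen (hT _)
  nabla_app T hT y hy J e := by
    simp only [nabla_snoc]
    have dG := hG.differentiableAt ((hG.smooth (J 0) (J 1)).differentiableOn (by simp)) hy
    have e₁ : pd e (IndexOp.app (fun y X J => G y (J 0) (J 1) * X (fun s => J s.succ.succ)) T J) y =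
      G y (J 0) (J 1) * pd e (T fun s => J s.succ.succ) y
        + T (fun s => J s.succ.succ) y * pd e (fun z => G z (J 0) (J 1)) y :=
      pd_mul dG (hG.differentiableAt (hT _) hy) e
    have e₂ : ∀ (t : Fin k) m, (fun s : Fin k => Function.update J t.succ.succ m s.succ.succ) =
        Function.update (fun s : Fin k => J s.succ.succ) t m := fun t m =>
      Function.update_comp_eq_of_injective J
        ((Fin.succ_injective _).comp (Fin.succ_injective _)) t m
    rw [e₁, Fin.sum_univ_succ, Fin.sum_univ_succ, hG.pd_metric hy]
    have u₀ : ∀ m, Function.update J 0 m 1 = J 1 := fun m =>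
      Function.update_of_ne (Fin.succ_ne_zero (0 : Fin (k + 1))) m J
    have u₁ : ∀ m, Function.update J 1 m 0 = J 0 := fun m =>
      Function.update_of_ne (Fin.succ_ne_zero (0 : Fin (k + 1))).symm m J
    have u₂ : ∀ m, (fun s : Fin k => Function.update J 0 m s.succ.succ) = fun s => J s.succ.succ :=
      fun m => funext fun s => Function.update_of_ne (Fin.succ_ne_zero _) m J
    have u₃ : ∀ m, (fun s : Fin k => Function.update J 1 m s.succ.succ) = fun s => J s.succ.succ :=
      fun m => funext fun s => Function.update_of_ne
        (fun h => Fin.succ_ne_zero s (Fin.succ_injective _ h)) m J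
    have u₄ : ∀ (t : Fin k) m, Function.update J t.succ.succ m 0 = J 0 := fun t m =>
      Function.update_of_ne (Fin.succ_ne_zero t.succ).symm m J
    have u₅ : ∀ (t : Fin k) m, Function.update J t.succ.succ m 1 = J 1 := fun t m =>
      Function.update_of_ne (fun h => Fin.succ_ne_zero t (Fin.succ_injective _ h.symm)) m J
    simp only [IndexOp.app, e₂, Fin.succ_zero_eq_one, u₀, u₁, u₂, u₃, u₄, u₅, Function.update_self]
    have r : ∀ (a : ℝ) (F : Fin n → ℝ) (H : Fin n → ℝ), ∑ m, F m * (H m * a) =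
        a * ∑ m, F m * H m := fun a F H => by
      rw [Finset.mul_sum]; exact Finset.sum_congr rfl fun m _ => by ring
    have r' : ∑ s : Fin k, ∑ m, christoffel G m e (J s.succ.succ) y * (G y (J 0) (J 1) *
        T (Function.update (fun s : Fin k => J s.succ.succ) s m) y) = G y (J 0) (J 1) *
        ∑ s : Fin k, ∑ m, christoffel G m e (J s.succ.succ) y *
          T (Function.update (fun s : Fin k => J s.succ.succ) s m) y := by
      simp only [Finset.mul_sum]
      exact Finset.sum_congr rfl fun s _ => Finset.sum_congr rfl fun m _ => by ring
    rw [r, r, r']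
    ring

theorem trace (hG : IsLocalMetric G U) :
    IsParallel G U (fun y X J => ∑ i, ∑ j, (G y)⁻¹ i j * X (Matrix.vecCons i (Matrix.vecCons j J)) :
      IndexOp n (k + 2) k) where
  map_add y X X' J := by simp only [mul_add, Finset.sum_add_distrib]
  map_smul y c X J := by
    simp only [Finset.mul_sum]
    exact Finset.sum_congr rfl fun i _ => Finset.sum_congr rfl fun j _ => by ring
  times r T hT J := TimesDifferentiableOn.sum hG.isOpen _ fun i =>
    TimesDifferentiableOn.sum hG.isOpen _ fun j =>
    (TimesDifferentiableOn.of_contDiffOn hG.isOpen (hG.smooth_inv i j) r).mul hG.isOpen (hT _)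
  nabla_app T hT y hy J e := by
    have dH := fun i j => hG.differentiableAt ((hG.smooth_inv i j).differentiableOn (by simp)) hy
    have dT := fun I => hG.differentiableAt (hT I) hy
    have e₁ : pd e (IndexOp.app (fun y X J => ∑ i, ∑ j, (G y)⁻¹ i j *
        X (Matrix.vecCons i (Matrix.vecCons j J))) T J) y = ∑ i, ∑ j,
        ((G y)⁻¹ i j * pd e (T (Matrix.vecCons i (Matrix.vecCons j J))) y
          + T (Matrix.vecCons i (Matrix.vecCons j J)) y * pd e (fun z => (G z)⁻¹ i j) y) := by
      refine (pd_sum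
        (F := fun i z => ∑ j, (G z)⁻¹ i j * T (Matrix.vecCons i (Matrix.vecCons j J)) z) _
        (fun i _ => DifferentiableAt.fun_sum fun j _ => (dH i j).fun_mul (dT _)) e).trans ?_
      refine Finset.sum_congr rfl fun i _ => ?_
      refine (pd_sum (F := fun j z => (G z)⁻¹ i j * T (Matrix.vecCons i (Matrix.vecCons j J)) z)
        _ (fun j _ => (dH i j).fun_mul (dT _)) e).trans ?_
      exact Finset.sum_congr rfl fun j _ => pd_mul (dH i j) (dT _) e
    have e₂ : ∀ i j (s : Fin k) m,
        Function.update (Matrix.vecCons i (Matrix.vecCons j J)) s.succ.succ m =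
          Matrix.vecCons i (Matrix.vecCons j (Function.update J s m)) := by
      intro i j s m
      simp only [Matrix.vecCons, Fin.cons_update]
    have e₃ : ∀ i j m, Function.update (Matrix.vecCons i (Matrix.vecCons j J)) (Fin.succ 0) m =
        Matrix.vecCons i (Matrix.vecCons m J) := by
      intro i j m
      simp only [Matrix.vecCons, ← Fin.cons_update, Fin.update_cons_zero]
    have e₄ : ∀ i j m, Function.update (Matrix.vecCons i (Matrix.vecCons j J)) 0 m =
        Matrix.vecCons m (Matrix.vecCons j J) := by
      intro i j m
      simp only [Matrix.vecCons, Fin.update_cons_zero]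
    simp only [nabla_snoc, Fin.sum_univ_succ]
    rw [e₁]
    simp only [e₂, e₃, e₄, Matrix.cons_val_zero, Matrix.cons_val_succ, IndexOp.app, hG.pd_inv hy]
    have c₁ : ∀ (γ h t : Fin n → Fin n → ℝ), ∑ i, ∑ j, t i j * ∑ m, γ i m * h m j =
        ∑ i, ∑ j, h i j * ∑ m, γ m i * t m j := by
      intro γ h t
      simp only [Finset.mul_sum]
      have sw : ∀ F : Fin n → Fin n → Fin n → ℝ,
          ∑ i, ∑ j, ∑ m, F i j m = ∑ m, ∑ j, ∑ i, F i j m := fun F => by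
        rw [Finset.sum_comm, Finset.sum_congr rfl fun j _ => Finset.sum_comm, Finset.sum_comm]
      rw [sw]
      exact Finset.sum_congr rfl fun i _ => Finset.sum_congr rfl fun j _ =>
        Finset.sum_congr rfl fun m _ => by ring
    have c₂ : ∀ (γ h t : Fin n → Fin n → ℝ), ∑ i, ∑ j, t i j * ∑ m, γ j m * h i m =
        ∑ i, ∑ j, h i j * ∑ m, γ m j * t i m := by
      intro γ h t
      refine Finset.sum_congr rfl fun i _ => ?_
      simp only [Finset.mul_sum]
      rw [Finset.sum_comm]
      exact Finset.sum_congr rfl fun j _ => Finset.sum_congr rfl fun m _ => by ring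
    have c₃ : ∑ s, ∑ m, christoffel G m e (J s) y * ∑ i, ∑ j, (G y)⁻¹ i j *
          T (Matrix.vecCons i (Matrix.vecCons j (Function.update J s m))) y =
        ∑ i, ∑ j, (G y)⁻¹ i j * ∑ s, ∑ m, christoffel G m e (J s) y *
          T (Matrix.vecCons i (Matrix.vecCons j (Function.update J s m))) y := by
      simp only [Finset.mul_sum]
      have sw : ∀ F : Fin k → Fin n → Fin n → Fin n → ℝ,
          ∑ s, ∑ m, ∑ i, ∑ j, F s m i j = ∑ i, ∑ j, ∑ s, ∑ m, F s m i j := fun F => by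
        have s₁ : ∀ s, ∑ m, ∑ i, ∑ j, F s m i j = ∑ i, ∑ j, ∑ m, F s m i j := fun s => by
          rw [Finset.sum_comm]
          exact Finset.sum_congr rfl fun i _ => Finset.sum_comm
        rw [Finset.sum_congr rfl fun s _ => s₁ s, Finset.sum_comm]
        exact Finset.sum_congr rfl fun i _ => Finset.sum_comm
      rw [sw]
      exact Finset.sum_congr rfl fun i _ => Finset.sum_congr rfl fun j _ =>
        Finset.sum_congr rfl fun s _ => Finset.sum_congr rfl fun m _ => by ring
    rw [c₃]
    simp only [mul_add, mul_sub, mul_neg, Finset.sum_add_distrib, Finset.sum_sub_distrib,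
      Finset.sum_neg_distrib]
    rw [c₁ (fun i m => christoffel G i e m y) (fun i j => (G y)⁻¹ i j)
        (fun i j => T (Matrix.vecCons i (Matrix.vecCons j J)) y),
      c₂ (fun i m => christoffel G i e m y) (fun i j => (G y)⁻¹ i j)
        (fun i j => T (Matrix.vecCons i (Matrix.vecCons j J)) y)]
    ring

end IsParallel

/-! ### The Ricci identity -/

/-- The Ricci identity for tensor fields with lower indices. -/
theorem ricci_identity (hG : IsLocalMetric G U) {T : Comp n k}
    (hT : ∀ I, TimesDifferentiableOn 2 (T I) U) {y : Coord n} (hy : y ∈ U) (I : Fin k → Fin n)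
    (i j : Fin n) :
    nabla G (nabla G T) (Fin.snoc (α := fun _ => Fin n) (Fin.snoc (α := fun _ => Fin n) I i) j) y
      - nabla G (nabla G T)
        (Fin.snoc (α := fun _ => Fin n) (Fin.snoc (α := fun _ => Fin n) I j) i) y =
    -∑ s, ∑ m, riemann G m (I s) j i y * T (Function.update I s m) y := by
  have dT := fun I => hG.differentiableAt (hT I).1 hy
  have dpT := fun I i => hG.differentiableAt ((hT I).2 i).1 hy
  have dΓ := fun m i j => hG.differentiableAt
    ((hG.smooth_christoffel m i j).differentiableOn (by simp)) hy
  -- the double sum that arises from the two Christoffel terms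
  let q : Fin n → Fin n → Fin k → Fin k → ℝ := fun j i s t =>
    ∑ m, ∑ p, christoffel G m j (I s) y * (christoffel G p i (Function.update I s m t) y *
      T (Function.update (Function.update I s m) t p) y)
  have expand : ∀ i j, nabla G (nabla G T)
      (Fin.snoc (α := fun _ => Fin n) (Fin.snoc (α := fun _ => Fin n) I i) j) y =
      pd j (pd i (T I)) y
      - ∑ s, ∑ m, (christoffel G m i (I s) y * pd j (T (Function.update I s m)) y
        + T (Function.update I s m) y * pd j (christoffel G m i (I s)) y)
      - ∑ s, ∑ m, christoffel G m j (I s) y * pd i (T (Function.update I s m)) y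
      + ∑ s, ∑ t, q j i s t
      - ∑ m, christoffel G m j i y * nabla G T (Fin.snoc (α := fun _ => Fin n) I m) y := by
    intro i j
    have e₁ : nabla G T (Fin.snoc (α := fun _ => Fin n) I i) = fun z => pd i (T I) z
      - ∑ s, ∑ m, christoffel G m i (I s) z * T (Function.update I s m) z :=
      funext fun z => nabla_snoc T I i z
    have e₂ : pd j (nabla G T (Fin.snoc (α := fun _ => Fin n) I i)) y = pd j (pd i (T I)) y
      - ∑ s, ∑ m, (christoffel G m i (I s) y * pd j (T (Function.update I s m)) y
        + T (Function.update I s m) y * pd j (christoffel G m i (I s)) y) := by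
      rw [e₁, pd_sub (dpT I i) (DifferentiableAt.fun_sum fun s _ => DifferentiableAt.fun_sum
        fun m _ => (dΓ _ _ _).fun_mul (dT _)), pd_sum (F := fun s z => ∑ m,
        christoffel G m i (I s) z * T (Function.update I s m) z) _
        fun s _ => DifferentiableAt.fun_sum fun m _ => (dΓ _ _ _).fun_mul (dT _)]
      congr 1
      refine Finset.sum_congr rfl fun s _ => ?_
      rw [pd_sum (F := fun m z => christoffel G m i (I s) z * T (Function.update I s m) z) _
        fun m _ => (dΓ _ _ _).fun_mul (dT _)]
      exact Finset.sum_congr rfl fun m _ => pd_mul (dΓ _ _ _) (dT _) j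
    have e₃ : ∑ s, ∑ m, christoffel G m j (I s) y *
        nabla G T (Fin.snoc (α := fun _ => Fin n) (Function.update I s m) i) y =
        ∑ s, ∑ m, christoffel G m j (I s) y * pd i (T (Function.update I s m)) y
          - ∑ s, ∑ t, q j i s t := by
      rw [← Finset.sum_sub_distrib]
      refine Finset.sum_congr rfl fun s _ => ?_
      simp only [nabla_snoc, mul_sub, Finset.sum_sub_distrib, q]
      congr 1
      rw [Finset.sum_comm]
      simp only [Finset.mul_sum]
    rw [nabla_snoc_snoc, nabla_snoc, e₂, e₃]
    ring
  have cross : ∑ s, ∑ t, q j i s t - ∑ s, ∑ t, q i j s t = ∑ s, (q j i s s - q i j s s) := by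
    rw [Finset.sum_comm (f := fun s t => q i j s t), ← Finset.sum_sub_distrib]
    refine Finset.sum_congr rfl fun s _ => ?_
    rw [← Finset.sum_sub_distrib, Finset.sum_eq_single s]
    · intro t _ hts
      simp only [q]
      rw [sub_eq_zero, Finset.sum_comm]
      refine Finset.sum_congr rfl fun p _ => Finset.sum_congr rfl fun m _ => ?_
      rw [Function.update_of_ne hts, Function.update_of_ne hts.symm, Function.update_comm hts.symm]
      ring
    · simp
  have diag : ∀ i j s, q j i s s = ∑ m, (∑ p, christoffel G p j (I s) y * christoffel G m i p y) *
      T (Function.update I s m) y := by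
    intro i j s
    simp only [q, Function.update_self, Function.update_idem, Finset.sum_mul]
    rw [Finset.sum_comm]
    exact Finset.sum_congr rfl fun m _ => Finset.sum_congr rfl fun p _ => by ring
  rw [expand i j, expand j i, pd_comm hG.isOpen (hT I).1 (fun i => ((hT I).2 i).1) hy i j]
  have hsymm : ∀ m, christoffel G m j i y = christoffel G m i j y := fun m =>
    hG.christoffel_symm hy m j i
  simp only [hsymm]
  have main : ∑ s, (q j i s s - q i j s s)
      - ∑ s, ∑ m, T (Function.update I s m) y * pd j (christoffel G m i (I s)) y
      + ∑ s, ∑ m, T (Function.update I s m) y * pd i (christoffel G m j (I s)) y =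
      -∑ s, ∑ m, riemann G m (I s) j i y * T (Function.update I s m) y := by
    simp only [diag, ← Finset.sum_sub_distrib, ← Finset.sum_add_distrib, ← Finset.sum_neg_distrib]
    refine Finset.sum_congr rfl fun s _ => Finset.sum_congr rfl fun m _ => ?_
    simp only [riemann, Finset.sum_sub_distrib]
    have c : ∀ i j, ∑ p, christoffel G p j (I s) y * christoffel G m i p y =
      ∑ p, christoffel G m i p y * christoffel G p j (I s) y := fun i j =>
      Finset.sum_congr rfl fun p _ => mul_comm _ _
    rw [c, c]
    ring
  simp only [Finset.sum_add_distrib] at main ⊢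
  linear_combination main + cross

/-- The Ricci identity in a space of constant curvature `K`. -/
theorem ricci_identity_of_constant_curvature (hG : IsLocalMetric G U) {K : ℝ}
    (hK : ∀ y ∈ U, ∀ a b c d, riemannLow G a b c d y =
      K * (G y a c * G y b d - G y a d * G y b c)) {T : Comp n k}
    (hT : ∀ I, TimesDifferentiableOn 2 (T I) U) {y : Coord n} (hy : y ∈ U) (I : Fin k → Fin n)
    (i j : Fin n) :
    nabla G (nabla G T) (Fin.snoc (α := fun _ => Fin n) (Fin.snoc (α := fun _ => Fin n) I i) j) y
      - nabla G (nabla G T)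
        (Fin.snoc (α := fun _ => Fin n) (Fin.snoc (α := fun _ => Fin n) I j) i) y =
    K * ∑ s, (G y (I s) j * T (Function.update I s i) y
      - G y (I s) i * T (Function.update I s j) y) := by
  have hI := hG.isInversePair hy
  have hR : ∀ m b c d, riemann G m b c d y =
      K * ((if c = m then 1 else 0) * G y b d - (if d = m then 1 else 0) * G y b c) := by
    intro m b c d
    rw [hG.riemann_eq_sum_riemannLow hy, ← hI.inv_mul, ← hI.inv_mul]
    simp only [hK y hy, Finset.sum_mul, ← Finset.sum_sub_distrib, Finset.mul_sum]
    exact Finset.sum_congr rfl fun a _ => by ring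
  rw [ricci_identity hG hT hy, ← Finset.sum_neg_distrib, Finset.mul_sum]
  refine Finset.sum_congr rfl fun s _ => ?_
  simp only [hR, mul_sub, sub_mul, Finset.sum_sub_distrib]
  simp [hI.symm]
  ring

end Parallel

/-! ### Tuples of indices -/

section Tuples

variable {α : Type*} {k : ℕ}

theorem snoc_vecCons (a : α) (v : Fin k → α) (d : α) :
    (Fin.snoc (α := fun _ => α) (Matrix.vecCons a v) d : Fin (k + 2) → α) =
      Matrix.vecCons a (Fin.snoc (α := fun _ => α) v d) :=
  (Fin.cons_snoc_eq_snoc_cons (β := α) a v d).symm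

theorem snoc_vecEmpty (v : Fin 0 → α) (d : α) :
    (Fin.snoc (α := fun _ => α) v d : Fin 1 → α) = ![d] := by
  funext s; fin_cases s; rfl

theorem init_vecCons (a b : α) (v : Fin k → α) :
    (Fin.init (α := fun _ => α) (Matrix.vecCons a (Matrix.vecCons b v)) : Fin (k + 1) → α) =
      Matrix.vecCons a (Fin.init (α := fun _ => α) (Matrix.vecCons b v)) := by
  funext s; refine Fin.cases rfl (fun s => ?_) s; rfl

theorem init_vecSingle (a : α) :
    (Fin.init (α := fun _ => α) ![a] : Fin 0 → α) = ![] := Subsingleton.elim _ _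

theorem comp_cons {β : Type*} (J : β → α) (a : β) (v : Fin k → β) :
    (fun s => J (Matrix.vecCons a v s)) = Matrix.vecCons (J a) (fun s => J (v s)) := by
  funext s; refine Fin.cases rfl (fun s => ?_) s; rfl

theorem comp_empty {β : Type*} (J : β → α) :
    (fun s => J ((![] : Fin 0 → β) s)) = ![] := Subsingleton.elim _ _

end Tuples

/-! ### The Lanczos expression as a parallel operation -/

section Local

variable {n k l : ℕ} {G : Coord n → Matrix (Fin n) (Fin n) ℝ} {U : Set (Coord n)}

theorem TimesDifferentiableOn.nabla (hG : IsLocalMetric G U) {r : ℕ} {T : Comp n k}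
    (hT : ∀ I, TimesDifferentiableOn (r + 1) (T I) U) (I : Fin (k + 1) → Fin n) :
    TimesDifferentiableOn r (nabla G T I) U := by
  refine ((hT _).2 _).sub hG.isOpen ?_
  exact .sum hG.isOpen _ fun s => .sum hG.isOpen _ fun m =>
    (TimesDifferentiableOn.of_contDiffOn hG.isOpen (hG.smooth_christoffel _ _ _) r).mul hG.isOpen
      (hT _).of_succ

namespace IsParallel

theorem sum (hG : IsLocalMetric G U) {m : ℕ} {Φ : Fin m → IndexOp n k l}
    (hΦ : ∀ s, IsParallel G U (Φ s)) : IsParallel G U (fun y X J => ∑ s, Φ s y X J) := by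
  induction m with
  | zero =>
    simp only [Finset.univ_eq_empty, Finset.sum_empty]
    refine ⟨fun _ _ _ _ => by simp, fun _ _ _ _ => by simp,
      fun r T _ J => TimesDifferentiableOn.const hG.isOpen r 0, fun T _ y _ J e => ?_⟩
    have : ∀ J, IndexOp.app (fun _ _ _ => 0 : IndexOp n k l) T J = fun _ => 0 := fun J => rfl
    simp [nabla_snoc, this, pd_const]
  | succ m ih =>
    simp only [Fin.sum_univ_succ]
    exact (hΦ 0).add hG (ih fun s => hΦ s.succ)

theorem congr {Φ Φ' : IndexOp n k l} (hΦ : IsParallel G U Φ) (H : ∀ y X J, Φ' y X J = Φ y X J) :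
    IsParallel G U Φ' := by
  have : Φ' = Φ := by funext y X J; exact H y X J
  rwa [this]

theorem id : IsParallel G U (fun _ X J => X J : IndexOp n k k) :=
  permute (σ := fun s => s) Function.bijective_id

theorem permute_trace (hG : IsLocalMetric G U) {σ : Fin (k + 2) → Fin (k + 2)}
    (hσ : Function.Bijective σ) :
    IsParallel G U (fun y X J => ctr (G y)⁻¹ fun i j =>
      X (fun s => Matrix.vecCons i (Matrix.vecCons j J) (σ s)) : IndexOp n (k + 2) k) :=
  (trace hG).comp (permute hσ)

theorem metric_mul_permute (hG : IsLocalMetric G U) {τ : Fin (k + 2) → Fin (k + 2)}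
    (hτ : Function.Bijective τ) :
    IsParallel G U (fun y X J => G y (J (τ 0)) (J (τ 1)) * X (fun s => J (τ s.succ.succ)) :
      IndexOp n k (k + 2)) :=
  (permute hτ).comp (metric_mul hG)

end IsParallel

/-- The index operation given by `weylOp`. -/
noncomputable def weylIndexOp (G : Coord n → Matrix (Fin n) (Fin n) ℝ) : IndexOp n 4 4 :=
  fun y X J => weylOp (G y) (G y)⁻¹ (fun a b c d => X ![a, b, c, d]) (J 0) (J 1) (J 2) (J 3)

theorem isParallel_lam (hG : IsLocalMetric G U) : IsParallel G U (fun y X J =>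
    lam (G y)⁻¹ (fun a b c d => X ![a, b, c, d]) (J 0) (J 1) : IndexOp n 4 2) := by
  refine (IsParallel.permute_trace hG (σ := ![3, 0, 2, 1]) (by decide)).congr fun y X J => ?_
  simp only [lam]
  refine ctr_congr fun i j => congrArg X ?_
  funext s; fin_cases s <;> rfl

theorem isParallel_dvec (hG : IsLocalMetric G U) : IsParallel G U (fun y X J =>
    dvec (G y)⁻¹ (fun a b c d => X ![a, b, c, d]) (J 0) (J 1) : IndexOp n 4 2) := by
  refine (IsParallel.permute_trace hG (σ := ![2, 0, 1, 3]) (by decide)).congr fun y X J => ?_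
  simp only [dvec]
  refine ctr_congr fun i j => congrArg X ?_
  funext s; fin_cases s <;> rfl

theorem isParallel_scal (hG : IsLocalMetric G U) : IsParallel G U (fun y X _ =>
    scal (G y)⁻¹ (fun a b c d => X ![a, b, c, d]) : IndexOp n 4 0) := by
  refine ((IsParallel.permute_trace hG (k := 0) (σ := fun s => s) Function.bijective_id).comp
    (IsParallel.permute_trace hG (k := 2) (σ := ![0, 2, 1, 3]) (by decide))).congr fun y X J => ?_
  simp only [scal]
  refine ctr_congr fun j l => ctr_congr fun i k => congrArg X ?_
  funext s; fin_cases s <;> rfl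

theorem isParallel_schouten (hG : IsLocalMetric G U) : IsParallel G U (fun y X J =>
    schouten (G y) (G y)⁻¹ (fun a b c d => X ![a, b, c, d]) (J 0) (J 1) : IndexOp n 4 2) := by
  have sw : IsParallel G U (fun _ X J => X (fun s => J ((![1, 0] : Fin 2 → Fin 2) s)) :
    IndexOp n 2 2) := IsParallel.permute (by decide)
  have hl := isParallel_lam hG
  have hd := isParallel_dvec hG
  refine (((((hl.add hG (sw.comp hl)).sub hG hd).sub hG (sw.comp hd)).const_mul hG
    ((n : ℝ) - 2)⁻¹).sub hG (((IsParallel.metric_mul hG).comp (isParallel_scal hG)).const_mul hG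
      (2 / (((n : ℝ) - 2) * ((n : ℝ) - 1))))).congr fun y X J => ?_
  simp only [schouten, Matrix.cons_val_zero, Matrix.cons_val_one]
  ring

theorem isParallel_weylIndexOp (hG : IsLocalMetric G U) : IsParallel G U (weylIndexOp G) := by
  have p : ∀ σ : Fin 4 → Fin 4, Function.Bijective σ →
    IsParallel G U (fun _ X J => X (fun s => J (σ s)) : IndexOp n 4 4) := fun σ hσ => .permute hσ
  have m : ∀ τ : Fin 4 → Fin 4, Function.Bijective τ → _ := fun τ hτ =>
    (IsParallel.metric_mul_permute hG hτ).comp (isParallel_schouten hG)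
  refine ((((p ![0, 1, 2, 3] (by decide)).sub hG (p ![0, 1, 3, 2] (by decide))).add hG
    (p ![2, 3, 0, 1] (by decide))).sub hG (p ![2, 3, 1, 0] (by decide))).sub hG
    ((((m ![0, 2, 1, 3] (by decide)).sub hG (m ![1, 2, 0, 3] (by decide))).sub hG
    (m ![0, 3, 1, 2] (by decide))).add hG (m ![1, 3, 0, 2] (by decide))) |>.congr fun y X J => ?_
  simp only [weylIndexOp, weylOp, comp_cons, comp_empty]
  rfl

/-! ### The curvature as a parallel operation -/

/-- The index operation `X_{a₁…aₖ} ↦ ∑ₛ g_{aₛ j} X_{…i…}`, where `i` stands in the place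
`s` and `i`, `j` are the last two indices of the result. -/
def rotOp (G : Coord n → Matrix (Fin n) (Fin n) ℝ) : IndexOp n k (k + 2) := fun y X J =>
  ∑ s : Fin k, G y (J s.castSucc.castSucc) (J (Fin.last _)) *
    X (Function.update (fun t => J t.castSucc.castSucc) s (J (Fin.last _).castSucc))

theorem isParallel_rotOp (hG : IsLocalMetric G U) :
    IsParallel G U (rotOp G : IndexOp n k (k + 2)) := by
  let τ : Fin k → Fin (k + 2) → Fin (k + 2) := fun s => Matrix.vecCons s.castSucc.castSucc
    (Matrix.vecCons (Fin.last _) (Function.update (fun t => t.castSucc.castSucc) s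
      (Fin.last _).castSucc))
  have hτ : ∀ s, Function.Bijective (τ s) := by
    intro s
    refine Finite.surjective_iff_bijective.1 fun t => ?_
    induction t using Fin.lastCases with
    | last => exact ⟨1, rfl⟩
    | cast t =>
      induction t using Fin.lastCases with
      | last => exact ⟨s.succ.succ, by simp [τ]⟩
      | cast t =>
        by_cases h : t = s
        · exact ⟨0, by simp [τ, h]⟩
        · exact ⟨t.succ.succ, by simp [τ, h]⟩
  refine (IsParallel.sum hG fun s => IsParallel.metric_mul_permute hG (hτ s)).congr fun y X J => ?_
  refine Finset.sum_congr rfl fun s _ => ?_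
  congr 2
  funext t
  by_cases h : t = s
  · subst h; simp [τ]
  · simp [τ, h]

end Local

/-! ### The jet of a Lanczos potential -/

section Local

variable {n k l : ℕ} {G : Coord n → Matrix (Fin n) (Fin n) ℝ} {U : Set (Coord n)}

/-- The transposition of the last two places. -/
def swapLast (s : Fin (k + 2)) : Fin (k + 2) :=
  Equiv.swap (Fin.last _).castSucc (Fin.last _) s

theorem snoc_snoc_swapLast {α : Type*} (I : Fin k → α) (i j : α) :
    (fun s => (Fin.snoc (α := fun _ => α) (Fin.snoc (α := fun _ => α) I i) j : Fin (k + 2) → α)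
      (swapLast s)) = Fin.snoc (α := fun _ => α) (Fin.snoc (α := fun _ => α) I j) i := by
  funext s
  induction s using Fin.lastCases with
  | last => simp [swapLast]
  | cast s =>
    induction s using Fin.lastCases with
    | last => simp [swapLast]
    | cast s =>
      have h₁ : s.castSucc.castSucc ≠ (Fin.last k).castSucc := by
        simp [Fin.ext_iff, s.isLt.ne]
      have h₂ : s.castSucc.castSucc ≠ Fin.last (k + 1) := by
        simp only [ne_eq, Fin.ext_iff, Fin.val_castSucc, Fin.val_last]; omega
      simp [swapLast, Equiv.swap_apply_of_ne_of_ne h₁ h₂]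

/-- The commutator of the last two indices. -/
def commOp : IndexOp n (k + 2) (k + 2) := fun _ X J => X J - X (fun s => J (swapLast s))

/-- The curvature of a space of constant curvature `K`, acting on the indices of an array. -/
def curvOp (G : Coord n → Matrix (Fin n) (Fin n) ℝ) (K : ℝ) : IndexOp n k (k + 2) := fun y X J =>
  K * (rotOp G y X J - rotOp G y X (fun s => J (swapLast s)))

theorem isParallel_commOp (hG : IsLocalMetric G U) :
    IsParallel G U (commOp : IndexOp n (k + 2) (k + 2)) :=
  IsParallel.id.sub hG (.permute (Equiv.swap _ _).bijective)

theorem isParallel_curvOp (hG : IsLocalMetric G U) (K : ℝ) :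
    IsParallel G U (curvOp G K : IndexOp n k (k + 2)) :=
  ((isParallel_rotOp hG).sub hG
    ((IsParallel.permute (Equiv.swap _ _).bijective).comp (isParallel_rotOp hG))).const_mul hG K

theorem commOp_eq_curvOp (hG : IsLocalMetric G U) {K : ℝ}
    (hK : ∀ y ∈ U, ∀ a b c d, riemannLow G a b c d y =
      K * (G y a c * G y b d - G y a d * G y b c)) {T : Comp n k}
    (hT : ∀ I, TimesDifferentiableOn 2 (T I) U) :
    ∀ y ∈ U, ∀ J, commOp.app (nabla G (nabla G T)) J y = (curvOp G K).app T J y := by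
  intro y hy J
  obtain ⟨J, j, rfl⟩ : ∃ J' i, J = Fin.snoc (α := fun _ => Fin n) J' i :=
    ⟨Fin.init J, J (Fin.last _), (Fin.snoc_init_self J).symm⟩
  obtain ⟨J, i, rfl⟩ : ∃ J' i, J = Fin.snoc (α := fun _ => Fin n) J' i :=
    ⟨Fin.init J, J (Fin.last _), (Fin.snoc_init_self J).symm⟩
  have := ricci_identity_of_constant_curvature hG hK hT hy J i j
  simp only [IndexOp.app, commOp, curvOp, snoc_snoc_swapLast]
  simpa [rotOp, Finset.sum_sub_distrib] using this

theorem swapLast_five {α : Type*} (a b c i j : α) :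
    (fun s => ![a, b, c, i, j] (swapLast s)) = ![a, b, c, j, i] := by
  have := snoc_snoc_swapLast ![a, b, c] i j
  simpa only [snoc_vecCons, snoc_vecEmpty] using this

theorem swapLast_six {α : Type*} (a b c d i j : α) :
    (fun s => ![a, b, c, d, i, j] (swapLast s)) = ![a, b, c, d, j, i] := by
  have := snoc_snoc_swapLast ![a, b, c, d] i j
  simpa only [snoc_vecCons, snoc_vecEmpty] using this

theorem swapLast_seven {α : Type*} (a b c d e i j : α) :
    (fun s => ![a, b, c, d, e, i, j] (swapLast s)) = ![a, b, c, d, e, j, i] := by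
  have := snoc_snoc_swapLast ![a, b, c, d, e] i j
  simpa only [snoc_vecCons, snoc_vecEmpty] using this

theorem rotOp_three (y : Coord n) (X : (Fin 3 → Fin n) → ℝ) (a b c i j : Fin n) :
    rotOp G y X ![a, b, c, i, j] = G y a j * X ![i, b, c] + G y b j * X ![a, i, c]
      + G y c j * X ![a, b, i] := by
  simp only [rotOp, Fin.sum_univ_three]
  congr! 4 <;> (funext s; fin_cases s <;> rfl)

theorem rotOp_four (y : Coord n) (X : (Fin 4 → Fin n) → ℝ) (a b c d i j : Fin n) :
    rotOp G y X ![a, b, c, d, i, j] = G y a j * X ![i, b, c, d] + G y b j * X ![a, i, c, d]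
      + G y c j * X ![a, b, i, d] + G y d j * X ![a, b, c, i] := by
  simp only [rotOp, Fin.sum_univ_four]
  congr! 5 <;> (funext s; fin_cases s <;> rfl)

theorem rotOp_five (y : Coord n) (X : (Fin 5 → Fin n) → ℝ) (a b c d e i j : Fin n) :
    rotOp G y X ![a, b, c, d, e, i, j] = G y a j * X ![i, b, c, d, e] + G y b j * X ![a, i, c, d, e]
      + G y c j * X ![a, b, i, d, e] + G y d j * X ![a, b, c, i, e]
      + G y e j * X ![a, b, c, d, i] := by
  simp only [rotOp, Fin.sum_univ_five]
  congr! 6 <;> (funext s; fin_cases s <;> rfl)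

/-- The covariant derivatives up to the fourth order of a tensor field with the symmetries of a
Lanczos potential, in a space of constant curvature. -/
theorem fullJetRelations (hG : IsLocalMetric G U) {K : ℝ}
    (hK : ∀ y ∈ U, ∀ a b c d, riemannLow G a b c d y =
      K * (G y a c * G y b d - G y a d * G y b c)) {L : Comp n 3}
    (hL : ∀ I, TimesDifferentiableOn 4 (L I) U)
    (anti : ∀ y ∈ U, ∀ a b c, L ![a, b, c] y = -L ![b, a, c] y)
    (cyc : ∀ y ∈ U, ∀ a b c, L ![a, b, c] y + L ![b, c, a] y + L ![c, a, b] y = 0)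
    {y : Coord n} (hy : y ∈ U) :
    FullJetRelations (G y) K (fun a b c => L ![a, b, c] y)
      (fun a b c d e => nabla G (nabla G L) ![a, b, c, d, e] y)
      (fun a b c d i j e => nabla G (nabla G (nabla G (nabla G L))) ![a, b, c, d, i, j, e] y) := by
  have t₁ := fun I => TimesDifferentiableOn.nabla hG hL I
  have t₂ := fun I => TimesDifferentiableOn.nabla hG t₁ I
  have t₃ := fun I => TimesDifferentiableOn.nabla hG t₂ I
  have t₄ := fun I => TimesDifferentiableOn.nabla hG t₃ I
  have d₀ : DiffOn L U := fun I => (hL I).1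
  have d₁ : DiffOn (nabla G L) U := fun I => (t₁ I).1
  have d₂ : DiffOn (nabla G (nabla G L)) U := fun I => (t₂ I).1
  have d₃ : DiffOn (nabla G (nabla G (nabla G L))) U := fun I => (t₃ I).1
  have hi : IsParallel G U (fun _ X J => X J : IndexOp n 3 3) := .id
  have p : ∀ σ : Fin 3 → Fin 3, Function.Bijective σ →
    IsParallel G U (fun _ X J => X (fun s => J (σ s)) : IndexOp n 3 3) := fun σ hσ => .permute hσ
  have ha := (p ![1, 0, 2] (by decide)).const_mul hG (-1)
  have hc := ((p ![1, 2, 0] (by decide)).add hG (p ![2, 0, 1] (by decide))).const_mul hG (-1)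
  have e : ∀ J : Fin 3 → Fin n, J = ![J 0, J 1, J 2] := fun J => by
    funext s; fin_cases s <;> rfl
  -- the symmetries of `L` and of its covariant derivatives
  have a₀ : ∀ y ∈ U, ∀ J, IndexOp.app (fun _ X J => X J : IndexOp n 3 3) L J y = _ := fun y hy J =>
    show L J y = IndexOp.app (fun y X J => -1 * X (fun s => J ((![1, 0, 2] : Fin 3 → Fin 3) s)) :
        IndexOp n 3 3) L J y by
      rw [e J, anti y hy]; simp [IndexOp.app, comp_cons, comp_empty, -Matrix.cons_val_fin_one]
  have a₁ := hi.transfer hG ha d₀ d₀ a₀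
  have a₂ := hi.passive.transfer hG ha.passive d₁ d₁ a₁
  have a₃ := hi.passive.passive.transfer hG ha.passive.passive d₂ d₂ a₂
  have a₄ := hi.passive.passive.passive.transfer hG ha.passive.passive.passive d₃ d₃ a₃
  have c₀ : ∀ y ∈ U, ∀ J, IndexOp.app (fun _ X J => X J : IndexOp n 3 3) L J y = _ := fun y hy J =>
    show L J y = IndexOp.app (fun y X J => -1 * (X (fun s => J ((![1, 2, 0] : Fin 3 → Fin 3) s))
        + X (fun s => J ((![2, 0, 1] : Fin 3 → Fin 3) s))) : IndexOp n 3 3) L J y by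
      have := cyc y hy (J 0) (J 1) (J 2)
      rw [e J]; simp [IndexOp.app, comp_cons, comp_empty, -Matrix.cons_val_fin_one]; linarith
  have c₁ := hi.transfer hG hc d₀ d₀ c₀
  have c₂ := hi.passive.transfer hG hc.passive d₁ d₁ c₁
  have c₃ := hi.passive.passive.transfer hG hc.passive.passive d₂ d₂ c₂
  have c₄ := hi.passive.passive.passive.transfer hG hc.passive.passive.passive d₃ d₃ c₃
  -- the Ricci identities for `L`, its first and its second covariant derivative
  have r₀ := commOp_eq_curvOp hG hK (T := L) fun I => (hL I).of_succ.of_succ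
  have hm : ∀ {k}, IsParallel G U (commOp : IndexOp n (k + 2) (k + 2)) := isParallel_commOp hG
  have hk : ∀ {k}, IsParallel G U (curvOp G K : IndexOp n k (k + 2)) := isParallel_curvOp hG K
  have r₁ := hm.transfer hG hk d₂ d₀ r₀
  have r₂ := hm.passive.transfer hG hk.passive d₃ d₁ r₁
  have s₀ := commOp_eq_curvOp hG hK (T := nabla G L) fun I => (t₁ I).of_succ
  have s₁ := hm.transfer hG hk d₃ d₁ s₀
  have q₀ := commOp_eq_curvOp hG hK (T := nabla G (nabla G L)) t₂
  refine ⟨anti y hy, cyc y hy, fun e => ⟨⟨fun a b c d => ?_, fun a b c d => ?_⟩,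
    fun i j => ⟨fun a b c d => ?_, fun a b c d => ?_⟩, fun a b c i j k => ?_,
    fun a b c d i j => ?_⟩, fun a b c i j => ?_, fun a b c d e i j => ?_⟩
  · have := a₂ y hy ![a, b, c, d, e]
    simpa [IndexOp.app, IndexOp.passive, init_vecCons, init_vecSingle, snoc_vecEmpty,
      comp_cons, comp_empty, -Matrix.cons_val_fin_one] using this
  · have := c₂ y hy ![a, b, c, d, e]
    simp [IndexOp.app, IndexOp.passive, init_vecCons, init_vecSingle, snoc_vecEmpty,
      comp_cons, comp_empty, -Matrix.cons_val_fin_one] at this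
    linarith
  · have := a₄ y hy ![a, b, c, d, i, j, e]
    simpa [IndexOp.app, IndexOp.passive, init_vecCons, init_vecSingle, snoc_vecEmpty,
      comp_cons, comp_empty, -Matrix.cons_val_fin_one] using this
  · have := c₄ y hy ![a, b, c, d, i, j, e]
    simp [IndexOp.app, IndexOp.passive, init_vecCons, init_vecSingle, snoc_vecEmpty,
      comp_cons, comp_empty, -Matrix.cons_val_fin_one] at this
    linarith
  · have := r₂ y hy ![a, b, c, i, j, k, e]
    simp [IndexOp.app, IndexOp.passive, init_vecCons, init_vecSingle, snoc_vecEmpty,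
      commOp, curvOp, swapLast_five, rotOp_three] at this
    linear_combination this
  · have := s₁ y hy ![a, b, c, d, i, j, e]
    simp [IndexOp.app, IndexOp.passive, init_vecCons, init_vecSingle, snoc_vecEmpty,
      commOp, curvOp, swapLast_six, rotOp_four] at this
    linear_combination this
  · have := r₀ y hy ![a, b, c, i, j]
    simp [IndexOp.app, commOp, curvOp, swapLast_five, rotOp_three] at this
    linear_combination this
  · have := q₀ y hy ![a, b, c, d, e, i, j]
    simp [IndexOp.app, commOp, curvOp, swapLast_seven, rotOp_five] at this
    linear_combination this

end Local

/-! ### The constraint in a chart -/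

section Local

variable {n : ℕ} {G : Coord n → Matrix (Fin n) (Fin n) ℝ} {U : Set (Coord n)}

theorem sum_four_eq_ctr_ctr (h : Matrix (Fin n) (Fin n) ℝ) (F : Fin n → Fin n → Fin n → Fin n → ℝ) :
    ∑ i, ∑ j, ∑ k, ∑ l, h i k * h j l * F i j k l =
      ctr h fun i k => ctr h fun j l => F i j k l := by
  simp only [ctr, Finset.mul_sum]
  refine Finset.sum_congr rfl fun i _ => ?_
  rw [Finset.sum_comm]
  exact Finset.sum_congr rfl fun k _ => Finset.sum_congr rfl fun j _ =>
    Finset.sum_congr rfl fun l _ => by ring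

theorem lanczosExpr_eq_weylOp (L : Comp n 3) (y : Coord n)
    (a b c d : Fin n) : lanczosExpr G L a b c d y =
      weylOp (G y) (G y)⁻¹ (fun a b c d => nabla G L ![a, b, c, d] y) a b c d := by
  have tr : ∀ b d, lanczosTrace G L b d y =
      dvec (G y)⁻¹ (fun a b c d => nabla G L ![a, b, c, d] y) b d * (-1)
        + lam (G y)⁻¹ (fun a b c d => nabla G L ![a, b, c, d] y) d b
        + lam (G y)⁻¹ (fun a b c d => nabla G L ![a, b, c, d] y) b d
        - dvec (G y)⁻¹ (fun a b c d => nabla G L ![a, b, c, d] y) d b := by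
    intro b d
    have : lanczosTrace G L b d y = ctr (G y)⁻¹ fun i j =>
      nabla G L ![b, i, d, j] y - nabla G L ![b, i, j, d] y
      + nabla G L ![d, i, b, j] y - nabla G L ![d, i, j, b] y := rfl
    rw [this]
    simp only [ctr_sub, ctr_add, lam, dvec]
    ring
  have sc : lanczosScalar G L y =
      scal (G y)⁻¹ (fun a b c d => nabla G L ![a, b, c, d] y) := by
    rw [lanczosScalar, sum_four_eq_ctr_ctr, ctr_ctr_comm]
    rfl
  simp only [lanczosExpr, alt₂, weylOp, schouten, tr, sc]
  ring

theorem timesDifferentiableOn_of_potential (hG : IsLocalMetric G U) {L : Comp n 3}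
    (hL : ∀ I, TimesDifferentiableOn 4 (L I) U) {W : Comp n 4}
    (hW : ∀ y ∈ U, ∀ J, W J y = (weylIndexOp G).app (nabla G L) J y) (J : Fin 4 → Fin n) :
    TimesDifferentiableOn 3 (W J) U :=
  ((isParallel_weylIndexOp hG).times 3 (nabla G L)
    (fun I => TimesDifferentiableOn.nabla hG hL I) J).congr hG.isOpen fun y hy => hW y hy J

theorem scalarCurvature_eq (hG : IsLocalMetric G U) {K : ℝ} {y : Coord n} (hy : y ∈ U)
    (hK : ∀ a b c d, riemannLow G a b c d y =
      K * (G y a c * G y b d - G y a d * G y b c)) :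
    scalarCurvature G y = -((n : ℝ) * ((n : ℝ) - 1) * K) := by
  have hI := hG.isInversePair hy
  have hRic : ∀ b c, ricci G b c y = K * (1 - n) * G y b c := by
    intro b c
    have : ricci G b c y = K * (ctr (G y)⁻¹ (fun m a => G y c a * G y b m)
      - ctr (G y)⁻¹ (fun m a => G y m a * G y b c)) := by
      rw [← ctr_sub, ← ctr_const_mul]
      refine Finset.sum_congr rfl fun m _ => ?_
      rw [hG.riemann_eq_sum_riemannLow hy]
      refine Finset.sum_congr rfl fun a _ => ?_
      rw [hK, hI.symm a c, hI.symm a m]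
    rw [this, hI.ctr_g_right, hI.ctr_g]
    ring
  have : scalarCurvature G y = ctr (G y)⁻¹ fun b c => G y b c * (K * (1 - n)) :=
    Finset.sum_congr rfl fun b _ => Finset.sum_congr rfl fun c _ => by rw [hRic]; ring
  rw [this, hI.ctr_g]
  ring

/-- A tensor field with a four times differentiable Lanczos potential satisfies the constraint. -/
theorem curvedConstraint_eq_zero_of_potential (hn : 5 ≤ n) (hG : IsLocalMetric G U) {K : ℝ}
    (hK : ∀ y ∈ U, ∀ a b c d, riemannLow G a b c d y =
      K * (G y a c * G y b d - G y a d * G y b c)) {L : Comp n 3}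
    (hL : ∀ I, TimesDifferentiableOn 4 (L I) U)
    (anti : ∀ y ∈ U, ∀ a b c, L ![a, b, c] y = -L ![b, a, c] y)
    (cyc : ∀ y ∈ U, ∀ a b c, L ![a, b, c] y + L ![b, c, a] y + L ![c, a, b] y = 0) {W : Comp n 4}
    (hW : ∀ y ∈ U, ∀ J, W J y = (weylIndexOp G).app (nabla G L) J y) {y : Coord n} (hy : y ∈ U)
    (a b e c d : Fin n) : curvedConstraint G W a b e c d y = 0 := by
  have hI := hG.isInversePair hy
  have t₁ := fun I => TimesDifferentiableOn.nabla hG hL I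
  have t₂ := fun I => TimesDifferentiableOn.nabla hG t₁ I
  have t₃ := fun I => TimesDifferentiableOn.nabla hG t₂ I
  have w₀ := fun I => timesDifferentiableOn_of_potential hG hL hW I
  have w₁ := fun I => TimesDifferentiableOn.nabla hG w₀ I
  have w₂ := fun I => TimesDifferentiableOn.nabla hG w₁ I
  have hi : IsParallel G U (fun _ X J => X J : IndexOp n 4 4) := .id
  have hw := isParallel_weylIndexOp hG
  have e₁ := hi.transfer hG hw (fun I => (w₀ I).1) (fun I => (t₁ I).1) hW
  have e₂ := hi.passive.transfer hG hw.passive (fun I => (w₁ I).1) (fun I => (t₂ I).1) e₁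
  have e₃ := hi.passive.passive.transfer hG hw.passive.passive (fun I => (w₂ I).1)
    (fun I => (t₃ I).1) e₂
  have W₁ : ∀ a b c d e, nabla G W ![a, b, c, d, e] y = weylOp (G y) (G y)⁻¹
      (fun p q r s => nabla G (nabla G L) ![p, q, r, s, e] y) a b c d := by
    intro a b c d e
    have := e₁ y hy ![a, b, c, d, e]
    simpa [IndexOp.app, IndexOp.passive, init_vecCons, init_vecSingle, snoc_vecEmpty,
      weylIndexOp] using this
  have W₃ : ∀ a b c d i j e, nabla G (nabla G (nabla G W)) ![a, b, c, d, i, j, e] y =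
      weylOp (G y) (G y)⁻¹ (fun p q r s =>
        nabla G (nabla G (nabla G (nabla G L))) ![p, q, r, s, i, j, e] y) a b c d := by
    intro a b c d i j e
    have := e₃ y hy ![a, b, c, d, i, j, e]
    simpa [IndexOp.app, IndexOp.passive, init_vecCons, init_vecSingle, snoc_vecEmpty,
      weylIndexOp] using this
  have J := (fullJetRelations hG hK hL anti cyc hy).constraint_eq_zero hI hn a b e c d
  have hn' : (5 : ℝ) ≤ n := by exact_mod_cast hn
  have h0 : (n : ℝ) ≠ 0 := by linarith
  have h1 : (n : ℝ) - 1 ≠ 0 := by linarith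
  have h3 : (n : ℝ) - 3 ≠ 0 := by linarith
  rw [curvedConstraint, flatConstraint, scalarCurvature_eq hG hy (hK y hy)]
  simp only [sum_four_eq_ctr_ctr, W₁, W₃]
  have hs : ∀ (B : Fin n → Arr₄ n) e, slice B e = fun a b c d => B a b c d e := fun _ _ => rfl
  simp only [divDiv, slice₃, hs, ctr] at J ⊢
  -- clear the denominator `n - 3` of the double divergence
  rw [← mul_right_inj' h3, mul_zero]
  refine Eq.trans ?_ J
  field_simp
  ring

end Local

/-! ### Charts of a manifold -/

section Charts

variable {n : ℕ} {M : Type*} [TopologicalSpace M] [ChartedSpace (Coord n) M]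
  {φ : OpenPartialHomeomorph M (Coord n)}

theorem frame_sum (y : Coord n) (v : Fin n → ℝ) :
    ∑ a, v a • frame φ y a =
      mfderiv (𝓡 n) (𝓡 n) φ.symm y (WithLp.toLp 2 v : Coord n) := by
  have e : (WithLp.toLp 2 v : Coord n) = ∑ a, v a • EuclideanSpace.single a (1 : ℝ) := by
    ext i
    simp [Pi.single_apply]
  have := map_sum (mfderiv (𝓡 n) (𝓡 n) φ.symm y) 
    (fun a => (v a • EuclideanSpace.single a (1 : ℝ) : Coord n)) Finset.univ
  rw [e]
  refine Eq.trans ?_ this.symm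
  refine Finset.sum_congr rfl fun a _ => ?_
  exact (map_smul (mfderiv (𝓡 n) (𝓡 n) φ.symm y) (v a)
    (EuclideanSpace.single a (1 : ℝ) : Coord n)).symm

/-- In a chart, a pseudo-Riemannian metric is a smooth field of symmetric invertible matrices. -/
theorem isLocalMetric_gram [IsManifold (𝓡 n) ∞ M] (g : Metric n M)
    (hφ : φ ∈ atlas (Coord n) M) : IsLocalMetric (gram φ g) φ.target where
  isOpen := φ.open_target
  smooth := g.smooth φ hφ
  symm y _ a b := g.symm ..
  isUnit y hy := by
    have : IsManifold (𝓡 n) 1 M := .of_le (n := ∞) (by simp)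
    have hm : φ.symm.MDifferentiable (𝓡 n) (𝓡 n) := (mdifferentiable_of_mem_atlas hφ).symm
    rw [isUnit_iff_ne_zero]
    intro h0
    obtain ⟨v, hv, hv'⟩ := Matrix.exists_mulVec_eq_zero_iff.2 h0
    apply hv
    let D := mfderiv (𝓡 n) (𝓡 n) φ.symm y
    have hinj : Function.Injective D := hm.mfderiv_injective hy
    have hsurj : Function.Surjective D := hm.mfderiv_surjective hy
    have hzero : ∑ a, v a • frame φ y a = 0 := by
      refine g.nondegenerate _ _ fun w => ?_
      obtain ⟨w, rfl⟩ := hsurj w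
      let w' : Coord n := w
      have hw : D w = ∑ b, w' b • frame φ y b := (frame_sum y fun b => w' b).symm
      rw [hw, map_sum]
      refine Finset.sum_eq_zero fun b _ => ?_
      have := congrFun hv' b
      simp only [Matrix.mulVec, dotProduct, gram, Matrix.of_apply, Pi.zero_apply] at this
      rw [map_smul, g.symm, map_sum]
      simp only [map_smul, smul_eq_mul]
      rw [Finset.sum_congr rfl fun a _ => mul_comm _ _, this, mul_zero]
    rw [frame_sum] at hzero
    have := hinj (hzero.trans (map_zero D).symm)
    funext i
    exact congrArg (fun u : Coord n => u i) this

end Charts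

/-! ### The constraint on a manifold -/

section Constraint

variable {n : ℕ} {M : Type*} [TopologicalSpace M] [ChartedSpace (Coord n) M]
  [IsManifold (𝓡 n) ∞ M]

theorem satisfiesCurvedConstraint_of_potential (hn : 5 ≤ n) (g : Metric n M) {K : ℝ}
    (hK : HasConstantCurvature g K) {W : TensorField n M 4} {L : TensorField n M 3}
    (hL : TimesDifferentiable 4 L) (hW : IsLanczosPotential g W L) :
    SatisfiesCurvedConstraint g W := by
  have key : ∀ φ ∈ atlas (Coord n) M, ∀ y ∈ φ.target, ∀ J, comp φ W J y =
      (weylIndexOp (gram φ g)).app (nabla (gram φ g) (comp φ L)) J y := by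
    intro φ hφ y hy J
    have e : J = ![J 0, J 1, J 2, J 3] := by funext s; fin_cases s <;> rfl
    have := hW.eq φ hφ y hy (J 0) (J 1) (J 2) (J 3)
    rw [← e, lanczosExpr_eq_weylOp] at this
    exact this
  refine ⟨fun φ hφ J => timesDifferentiableOn_of_potential (isLocalMetric_gram g hφ) (hL φ hφ)
    (key φ hφ) J, fun x φ hφ hx a b e c d => ?_⟩
  refine curvedConstraint_eq_zero_of_potential hn (isLocalMetric_gram g hφ) (hK φ hφ) (hL φ hφ)
    (fun y hy a b c => ?_) (fun y hy a b c => ?_) (key φ hφ) (φ.map_source hx) a b e c d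
  · have h₁ := hW.symmetry.antisymm φ hφ y hy a b c
    simp only [alt₂] at h₁
    linarith
  · have h₁ := hW.symmetry.cyclic φ hφ y hy a b c
    have h₂ := fun a b c => hW.symmetry.antisymm φ hφ y hy a b c
    simp only [alt₂, alt₃] at h₁ h₂
    linarith [h₂ a b c, h₂ b c a, h₂ c a b]

theorem curvedConstraintAt_iff_of_isFlat (g : Metric n M) (hg : IsFlat g) (W : TensorField n M 4)
    (x : M) : CurvedConstraintAt g W x ↔ FlatConstraintAt g W x := by
  refine forall₃_congr fun φ hφ hx => forall₅_congr fun a b e c d => ?_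
  have hy := φ.map_source hx
  have : scalarCurvature (gram φ g) (φ x) = 0 := by
    rw [scalarCurvature_eq (isLocalMetric_gram g hφ) hy (K := 0) fun a b c d => by
      rw [hg φ hφ _ hy, zero_mul]]
    ring
  rw [curvedConstraint, this]
  simp

end Constraint

/-! ### A Weyl candidate without potential in flat space -/

section Flat

variable {n : ℕ}

theorem christoffel_const (A : Matrix (Fin n) (Fin n) ℝ) (m i j : Fin n) :
    christoffel (fun _ => A) m i j = fun _ => 0 := by
  funext y
  simp [christoffel, pd_const]

theorem nabla_const (A : Matrix (Fin n) (Fin n) ℝ) {k : ℕ} (T : Comp n k)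
    (I : Fin (k + 1) → Fin n) :
    nabla (fun _ => A) T I = pd (I (Fin.last k)) (T (Fin.init I)) := by
  funext y
  simp [nabla, christoffel_const]

theorem pd_mul_pow (c : ℝ) (u i : Fin n) (m : ℕ) :
    pd i (fun z => c * z u ^ (m + 1)) = fun y =>
      c * (m + 1) * (if i = u then 1 else 0) * y u ^ m := by
  funext y
  have hu : HasFDerivAt (fun z : Coord n => z u) (EuclideanSpace.proj u : Coord n →L[ℝ] ℝ) y :=
    (EuclideanSpace.proj u : Coord n →L[ℝ] ℝ).hasFDerivAt
  have := ((hu.pow (m + 1)).const_mul c).fderiv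
  simp only [pd, this]
  by_cases h : i = u
  · subst h; simp; ring
  · simp [h]

theorem frame_refl (y : Coord n) (c : Fin n) :
    frame (OpenPartialHomeomorph.refl (Coord n)) y c =
      (EuclideanSpace.single c (1 : ℝ) : Coord n) := by
  have hid : mfderiv (𝓡 n) (𝓡 n) (OpenPartialHomeomorph.refl (Coord n)).symm y =
      ContinuousLinearMap.id ℝ (TangentSpace (𝓡 n) y) := mfderiv_id
  unfold frame
  rw [hid]
  rfl

/-- The matrix of the flat metric in Cartesian coordinates. -/
noncomputable def flatMatrix (ε : Fin n → ℤˣ) : Matrix (Fin n) (Fin n) ℝ :=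
  Matrix.diagonal fun i => ((ε i : ℤ) : ℝ)

theorem gram_flatMetric (ε : Fin n → ℤˣ) :
    gram (OpenPartialHomeomorph.refl (Coord n)) (flatMetric ε) = fun _ => flatMatrix ε := by
  funext y
  ext a b
  simp only [gram, frame_refl, Matrix.of_apply]
  change flatForm ε (EuclideanSpace.single a 1) (EuclideanSpace.single b 1) = _
  simp only [flatForm, LinearMap.mk₂_apply, flatMatrix]
  by_cases h : a = b
  · subst h; simp
  · simp [h, Ne.symm h]

theorem flatMatrix_inv (ε : Fin n → ℤˣ) : (flatMatrix ε)⁻¹ = flatMatrix ε := by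
  apply Matrix.inv_eq_right_inv
  rw [flatMatrix, Matrix.diagonal_mul_diagonal, ← Matrix.diagonal_one]
  congr 1
  funext i
  have : ((ε i : ℤ)) * (ε i : ℤ) = 1 := by rw [← Units.val_mul, Int.units_mul_self, Units.val_one]
  exact_mod_cast this

theorem isFlat_flatMetric (ε : Fin n → ℤˣ) : IsFlat (flatMetric ε) := by
  intro φ hφ y _ a b c d
  rw [chartedSpaceSelf_atlas] at hφ
  subst hφ
  simp [gram_flatMetric, riemannLow, riemann, christoffel_const, pd_const]

/-- The multilinear form with given components. -/
noncomputable def formOfComponents {k : ℕ} (c : (Fin k → Fin n) → ℝ) :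
    MultilinearMap ℝ (fun _ : Fin k => Coord n) ℝ :=
  ∑ I : Fin k → Fin n, c I • (MultilinearMap.mkPiAlgebra ℝ (Fin k) ℝ).compLinearMap fun s =>
    (EuclideanSpace.proj (I s) : Coord n →L[ℝ] ℝ)

theorem formOfComponents_single {k : ℕ} (c : (Fin k → Fin n) → ℝ) (I : Fin k → Fin n) :
    formOfComponents c (fun s => EuclideanSpace.single (I s) (1 : ℝ)) = c I := by
  have : ∀ J : Fin k → Fin n, ∏ s, (if J s = I s then (1 : ℝ) else 0) = if J = I then 1 else 0 := by
    intro J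
    rw [Fintype.prod_ite_zero]
    simp [funext_iff]
  simp [formOfComponents, this]

/-- The tensor field on `ℝⁿ` with given components in Cartesian coordinates. -/
noncomputable def ofComponents {k : ℕ} (c : Comp n k) : TensorField n (Coord n) k := fun x =>
  formOfComponents fun I => c I x

theorem comp_ofComponents {k : ℕ} (c : Comp n k) :
    comp (OpenPartialHomeomorph.refl (Coord n)) (ofComponents c) = c := by
  funext I y
  simp only [comp, frame_refl]
  exact formOfComponents_single (fun I => c I y) I

/-- The exterior product `p ∧ q` of two covectors. -/
def wedge (p q : Fin n → ℝ) (a b : Fin n) : ℝ := p a * q b - p b * q a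

/-- The algebraic curvature tensor `(p ∧ q) ⊙ (r ∧ t) - (p ∧ r) ⊙ (t ∧ q)` of four covectors, where
`⊙` is the symmetric product; the cyclic identity holds because the two terms have the same totally
antisymmetric part. If the covectors are orthogonal to each other, it is trace-free. -/
def weylTensor (p q r t : Fin n → ℝ) (a b c d : Fin n) : ℝ :=
  wedge p q a b * wedge r t c d + wedge r t a b * wedge p q c d
    - (wedge p r a b * wedge t q c d + wedge t q a b * wedge p r c d)

/-- The constant tensor `weylTensor` of the first four coordinate covectors. -/
def weylConst (hn : 5 ≤ n) : Arr₄ n :=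
  weylTensor (Pi.single (Fin.castLE hn 0) 1) (Pi.single (Fin.castLE hn 1) 1)
    (Pi.single (Fin.castLE hn 2) 1) (Pi.single (Fin.castLE hn 3) 1)

/-- The components of the Weyl candidate `(x⁴)³ C`, where `C` is the constant tensor `weylConst` and
the coordinates are numbered from `0`. -/
noncomputable def cubicWeyl (hn : 5 ≤ n) : Comp n 4 := fun I y =>
  weylConst hn (I 0) (I 1) (I 2) (I 3) * y (Fin.castLE hn 4) ^ 3

theorem isWeylCandidate_cubicWeyl (hn : 5 ≤ n) (ε : Fin n → ℤˣ) :
    IsWeylCandidate (flatMetric ε) (ofComponents (cubicWeyl hn)) := by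
  constructor <;> intro φ hφ y _ <;> rw [chartedSpaceSelf_atlas] at hφ <;> subst hφ <;>
    simp only [comp_ofComponents]
  · intro a b c d
    simp [cubicWeyl, alt₂, weylConst, weylTensor, wedge]
    ring
  · intro a b c d
    simp [cubicWeyl, alt₂, weylConst, weylTensor, wedge]
    ring
  · intro a b c d
    simp only [cubicWeyl, weylConst, weylTensor, Matrix.cons_val]
    ring
  · intro a b c d
    simp [cubicWeyl, alt₃, weylConst, weylTensor, wedge]
    ring
  · intro b d
    rw [gram_flatMetric, flatMatrix_inv]
    refine Finset.sum_eq_zero fun a _ => Finset.sum_eq_zero fun c _ => ?_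
    by_cases h : a = c
    · subst h
      -- different coordinate covectors are orthogonal, index by index
      have H : ∀ i j : Fin 5, i ≠ j → (Pi.single (Fin.castLE hn i) 1 : Fin n → ℝ) a *
          (Pi.single (Fin.castLE hn j) 1 : Fin n → ℝ) a = 0 := by
        intro i j hij
        have : Fin.castLE hn i ≠ Fin.castLE hn j := fun h => hij (Fin.castLE_injective hn h)
        by_cases h : a = Fin.castLE hn i
        · subst h; simp [this]
        · simp [Pi.single_apply, h]
      have h01 := H 0 1 (by decide)
      have h02 := H 0 2 (by decide)
      have h03 := H 0 3 (by decide)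
      have h12 := H 1 2 (by decide)
      have h13 := H 1 3 (by decide)
      have h23 := H 2 3 (by decide)
      have : weylConst hn a b a d = 0 := by
        simp only [weylConst, weylTensor, wedge]
        generalize (Pi.single (Fin.castLE hn 0) 1 : Fin n → ℝ) = p at *
        generalize (Pi.single (Fin.castLE hn 1) 1 : Fin n → ℝ) = q at *
        generalize (Pi.single (Fin.castLE hn 2) 1 : Fin n → ℝ) = r at *
        generalize (Pi.single (Fin.castLE hn 3) 1 : Fin n → ℝ) = t at *
        linear_combination (r b * t d + r d * t b) * h01 + (q b * t d + t b * q d) * h02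
          - 2 * (q b * r d + r b * q d) * h03 - 2 * (p b * t d + t b * p d) * h12
          + (p b * r d + r b * p d) * h13 + (q b * p d + p b * q d) * h23
      simp [cubicWeyl, this]
    · simp [flatMatrix, h]

/-- The component `[014]`, `[23]` of the flat constraint. Only `∂₄³` contributes, and the index `4`
does not occur in `C`, so that only the first term of the constraint is left. -/
theorem flatConstraint_cubicWeyl (hn : 5 ≤ n) (ε : Fin n → ℤˣ) (y : Coord n) :
    flatConstraint (fun _ => flatMatrix ε) (cubicWeyl hn) (Fin.castLE hn 0) (Fin.castLE hn 1)
      (Fin.castLE hn 4) (Fin.castLE hn 2) (Fin.castLE hn 3) y =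
        2 * ((ε (Fin.castLE hn 4) : ℤ) : ℝ) := by
  have W₃ : ∀ a b c d i j e, nabla (fun _ => flatMatrix ε) (nabla (fun _ => flatMatrix ε)
      (nabla (fun _ => flatMatrix ε) (cubicWeyl hn))) ![a, b, c, d, i, j, e] y =
      6 * weylConst hn a b c d * (if i = Fin.castLE hn 4 then 1 else 0) *
        (if j = Fin.castLE hn 4 then 1 else 0) * (if e = Fin.castLE hn 4 then 1 else 0) := by
    intro a b c d i j e
    have : cubicWeyl hn ![a, b, c, d] = fun y =>
      weylConst hn a b c d * y (Fin.castLE hn 4) ^ (2 + 1) := rfl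
    have l₁ : ![a, b, c, d, i] (Fin.last 4) = i := rfl
    have l₂ : ![a, b, c, d, i, j] (Fin.last (4 + 1)) = j := rfl
    have l₃ : ![a, b, c, d, i, j, e] (Fin.last (4 + 1 + 1)) = e := rfl
    simp only [nabla_const, init_vecCons, init_vecSingle, this, l₁, l₂, l₃, pd_mul_pow (m := 2)]
    rw [pd_mul_pow (m := 1), pd_mul_pow (m := 0)]
    push_cast
    ring
  have z : ∀ i j : Fin 5, Fin.castLE hn i = Fin.castLE hn j ↔ i = j := fun i j =>
    (Fin.castLE_injective hn).eq_iff
  have hd : ∀ i j, flatMatrix ε i j = if i = j then ((ε i : ℤ) : ℝ) else 0 := fun i j => rfl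
  simp only [flatConstraint, flatMatrix_inv, W₃, hd]
  simp [alt₃, alt₂, z, weylConst, weylTensor, wedge, Pi.single_apply]
  ring

theorem isSmooth_cubicWeyl (hn : 5 ≤ n) : IsSmooth (ofComponents (cubicWeyl hn)) := by
  intro φ hφ I
  rw [chartedSpaceSelf_atlas] at hφ
  subst hφ
  rw [comp_ofComponents]
  have : ContDiff ℝ ∞ (fun y : Coord n => y (Fin.castLE hn 4)) :=
    (EuclideanSpace.proj (Fin.castLE hn 4) : Coord n →L[ℝ] ℝ).contDiff
  exact (contDiff_const.mul (this.pow 3)).contDiffOn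

theorem not_flatConstraintAt_cubicWeyl (hn : 5 ≤ n) (ε : Fin n → ℤˣ) (x : Coord n) :
    ¬ FlatConstraintAt (flatMetric ε) (ofComponents (cubicWeyl hn)) x := by
  intro h
  have := h (OpenPartialHomeomorph.refl _) (by rw [chartedSpaceSelf_atlas]) trivial
    (Fin.castLE hn 0) (Fin.castLE hn 1) (Fin.castLE hn 4) (Fin.castLE hn 2) (Fin.castLE hn 3)
  rw [gram_flatMetric, comp_ofComponents, flatConstraint_cubicWeyl] at this
  simp at this

end Flat

end Lanczos

open Lanczos in
theorem theorem4 (n : ℕ) (hn : 5 ≤ n) :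
    -- on a manifold of constant curvature, failing the constraint excludes a potential
    (∀ (M : Type*) [TopologicalSpace M] [ChartedSpace (Coord n) M] [IsManifold (𝓡 n) ∞ M]
        (g : Metric n M) (K : ℝ), HasConstantCurvature g K →
        ∀ W : TensorField n M 4, IsWeylCandidate g W → ¬ SatisfiesCurvedConstraint g W →
          ¬ ∃ L : TensorField n M 3, TimesDifferentiable 4 L ∧ IsLanczosPotential g W L) ∧
    -- on a flat manifold the constraint reduces to the flat one
    (∀ (M : Type*) [TopologicalSpace M] [ChartedSpace (Coord n) M] [IsManifold (𝓡 n) ∞ M]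
        (g : Metric n M), IsFlat g →
        ∀ (W : TensorField n M 4) (x : M), CurvedConstraintAt g W x ↔ FlatConstraintAt g W x) ∧
    -- in flat space of any signature the constraint is an effective restriction
    (∀ ε : Fin n → ℤˣ, IsFlat (flatMetric ε) ∧
        ∃ W : TensorField n (Coord n) 4, IsSmooth W ∧ IsWeylCandidate (flatMetric ε) W ∧
          (∀ x, ¬ FlatConstraintAt (flatMetric ε) W x) ∧
          ¬ ∃ L : TensorField n (Coord n) 3,
            TimesDifferentiable 4 L ∧ IsLanczosPotential (flatMetric ε) W L) := by
  refine ⟨fun M _ _ _ g K hK W _ hW ⟨L, hL, hLW⟩ =>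
    hW (satisfiesCurvedConstraint_of_potential hn g hK hL hLW),
    fun M _ _ _ g hg W x => curvedConstraintAt_iff_of_isFlat g hg W x, fun ε =>
    ⟨isFlat_flatMetric ε, ofComponents (cubicWeyl hn), isSmooth_cubicWeyl hn,
      isWeylCandidate_cubicWeyl hn ε, not_flatConstraintAt_cubicWeyl hn ε, fun ⟨L, hL, hLW⟩ => ?_⟩⟩
  have hK : HasConstantCurvature (flatMetric ε) 0 := fun φ hφ y hy a b c d => by
    rw [isFlat_flatMetric ε φ hφ y hy, zero_mul]
  exact not_flatConstraintAt_cubicWeyl hn ε 0 <| (curvedConstraintAt_iff_of_isFlat _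
    (isFlat_flatMetric ε) _ 0).1 <|
      (satisfiesCurvedConstraint_of_potential hn _ hK hL hLW).2 0
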